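/- **Model.** Let the state be $\omega\in\{0,1\}$ and identify a belief with the probability $\mu\in[0,1]$ of state $1$. The adviser's posterior $s\in[0,1]$ has an (almost everywhere) strictly positive density $\tau$ on $[0,1]$, whose mean $\mu_0$ is the prior; given $s$, the state is $1$ with probability $s$. The agent has a type $\theta$ in a compact metric space $\Theta$, distributed according to $f(\omega)$ in state $\omega$ and independent of $s$ given $\omega$. Her actions lie in a nonempty compact metric space $A$, and her payoff $u(a,\omega,\theta)$ is bounded, measurable, and continuous in $a$. A private strategy is a measurable map $\rho:\Theta\to\Delta(A)$; its expected payoff at belief $\mu$ is $$U(\rho,\mu)=\mathbb E_{\omega\sim\mu,\ \theta\sim f(\omega),\ a\sim\rho(\theta)}[u(a,\omega,\theta)].$$ It is Bayes-optimal for $\mu$ if it maximizes $U(\cdot,\mu)$ over private strategies. Assume that the indirect payoff $U(\mu)=\sup_\rho U(\rho,\mu)$ is strictly convex on $[0,1]$ and twice differentiable on $(0,1)$. A strategy of the agent is a measurable map $\sigma:[0,1]\times\Theta\to\Delta(A)$, where the first argument is the adviser's message; write $\hat\sigma(m)=\sigma(m,\cdot)$. With probability $\alpha$ the adviser reports $m=s$,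 and with probability $1-\alpha$ he draws $m$ from $\beta(s)$ for an arbitrary measurable $\beta:[0,1]\to\Delta([0,1])$. The strategy $\sigma$ is optimal at $\alpha$ if it maximizes the guaranteed payoff $$\alpha\,\mathbb E_{s\sim\tau}\big[U(\hat\sigma(s),s)\big]+(1-\alpha)\inf_\beta\ \mathbb E_{s\sim\tau,\ m\sim\beta(s)}\big[U(\hat\sigma(m),s)\big].$$ It is a trust region strategy with compact trust region $T\subseteq[0,1]$ if $\hat\sigma(m)$ is Bayes-optimal for $m$ for every $m\in T$, and for every $m\notin T$ it is Bayes-optimal for some $P(m)\in\arg\max_{m'\in T}U(\hat\sigma(m'),m)$. **Proposition (Change in Alignment).** For every $\alpha\in[1/2,1]$ there is exactly one interval $[\underline\mu(\alpha),\overline\mu(\alpha)]\subseteq[0,1]$ that is the trust region of some optimal trust region strategy. On $[1/2,1]$, the function $\underline\mu$ is continuous and strictly decreasing and the function $\overline\mu$ is continuous and strictly increasing. Moreover $\underline\mu(1/2)=\overline\mu(1/2)=\mu_0$, $\underline\mu(1)=0$ and $\overline\mu(1)=1$. -/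

import Mathlib

open MeasureTheory ProbabilityTheory Set

namespace TrustRegion

/-- The binary-state advice model. The state is `ω : Fin 2`, a belief is the probability of
state `1`, an element of `unitInterval`; `A` is the action space, `Θ` the agent's type space. -/
structure Model (A Θ : Type*) [TopologicalSpace A] [MeasurableSpace A] [MeasurableSpace Θ] where
  /-- The agent's ex-post payoff `u(a, ω, θ)`. -/
  u : A → Fin 2 → Θ → ℝ
  measurable_u : ∀ ω, Measurable fun q : A × Θ => u q.1 ω q.2
  continuous_u : ∀ ω θ, Continuous fun a => u a ω θ
  bounded_u : ∃ C : ℝ, ∀ a ω θ, |u a ω θ| ≤ C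
  /-- The distribution of the agent's type in each state. -/
  f : Fin 2 → ProbabilityMeasure Θ
  /-- The density of the adviser's posterior. -/
  density : unitInterval → ℝ
  measurable_density : Measurable density
  density_pos : ∀ᵐ s : unitInterval, 0 < density s
  integral_density : ∫ s : unitInterval, density s = 1
  /-- The prior probability of state `1`. -/
  prior : unitInterval
  /-- The mean of the adviser's posterior is the prior. -/
  bayes_plausible : ∫ s : unitInterval, (s : ℝ) * density s = prior

/-- Mixed strategies, i.e. measurable maps from `X` to probability distributions on `Y`. -/
abbrev Strategy (X Y : Type*) [MeasurableSpace X] [MeasurableSpace Y] :=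
  {κ : Kernel X Y // IsMarkovKernel κ}

section

variable {A Θ : Type*} [TopologicalSpace A] [MeasurableSpace A] [MeasurableSpace Θ]

/-- The private strategy that the agent's strategy `σ` prescribes after message `m`. -/
def privateOf (σ : Strategy (unitInterval × Θ) A) (m : unitInterval) : Strategy Θ A :=
  ⟨σ.1.comap (fun θ => (m, θ)) measurable_prodMk_left,
    haveI := σ.2; Kernel.IsMarkovKernel.comap _ measurable_prodMk_left⟩

/-- The truthful adviser strategy `id`, which reports the posterior. -/
noncomputable def truthful : Strategy unitInterval unitInterval := ⟨Kernel.id, inferInstance⟩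

namespace Model

variable (E : Model A Θ)

/-- The distribution `τ` of the adviser's posterior. -/
noncomputable def posteriorLaw : Measure unitInterval :=
  volume.withDensity fun s => ENNReal.ofReal (E.density s)

/-- The expected payoff of a private strategy in state `ω`. -/
noncomputable def statePayoff (ρ : Strategy Θ A) (ω : Fin 2) : ℝ :=
  ∫ θ, ∫ a, E.u a ω θ ∂(ρ.1 θ) ∂(E.f ω : Measure Θ)

/-- The expected payoff `U(ρ, p)` of a private strategy `ρ` when state `1` has probability `p`. -/
noncomputable def privatePayoff (ρ : Strategy Θ A) (p : ℝ) : ℝ :=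
  (1 - p) * E.statePayoff ρ 0 + p * E.statePayoff ρ 1

/-- The indirect payoff function `U(p)`, the best payoff achievable at belief `p`. -/
noncomputable def indirect (p : ℝ) : ℝ := ⨆ ρ : Strategy Θ A, E.privatePayoff ρ p

def IsBayesOptimal (ρ : Strategy Θ A) (p : unitInterval) : Prop :=
  ∀ ρ' : Strategy Θ A, E.privatePayoff ρ' p ≤ E.privatePayoff ρ p

/-- The agent's expected payoff when the adviser plays `β` and the agent plays `σ`: the posterior
`s` is drawn from `τ`, the message `m` from `β s`, the state from `s`, the type from the state
(independently of `s` and `m`), and the action from `σ (m, θ)`. -/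
noncomputable def payoff (β : Strategy unitInterval unitInterval) (σ : Strategy (unitInterval × Θ) A) : ℝ :=
  ∫ s, ∫ m, E.privatePayoff (privateOf σ m) s ∂(β.1 s) ∂E.posteriorLaw

/-- The worst-case payoff of `σ` when the adviser is aligned with probability `α`. -/
noncomputable def guarantee (α : ℝ) (σ : Strategy (unitInterval × Θ) A) : ℝ :=
  α * E.payoff truthful σ + (1 - α) * ⨅ β : Strategy unitInterval unitInterval, E.payoff β σ

def IsOptimal (α : ℝ) (σ : Strategy (unitInterval × Θ) A) : Prop :=
  ∀ σ' : Strategy (unitInterval × Θ) A, E.guarantee α σ' ≤ E.guarantee α σ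

/-- `σ` is a trust region strategy with trust region `T`. -/
def IsTrustRegionStrategy (σ : Strategy (unitInterval × Θ) A) (T : Set unitInterval) : Prop :=
  IsCompact T ∧
  (∀ m ∈ T, E.IsBayesOptimal (privateOf σ m) m) ∧
  ∀ m ∉ T, ∃ p ∈ T,
    (∀ m' ∈ T, E.privatePayoff (privateOf σ m') m ≤ E.privatePayoff (privateOf σ p) m) ∧
    E.IsBayesOptimal (privateOf σ m) p

/-- `[l, h]` is a trust interval at alignment `α`: it is the trust region of an optimal strategy. -/
def IsTrustInterval (α : ℝ) (l h : unitInterval) : Prop :=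
  l ≤ h ∧ ∃ σ : Strategy (unitInterval × Θ) A, E.IsOptimal α σ ∧ E.IsTrustRegionStrategy σ (Icc l h)

end Model

end

end TrustRegion

/-! A private strategy has a payoff that is affine in the belief, so a strategy that is
Bayes-optimal at `p` is a line supporting the convex function `U` at `p`. Choosing `σ` is a zero-sum
game against the misaligned adviser, and the proof exhibits a saddle point of it, given by bounds `l
≤ h` and a cutoff `c` between them.

The adviser reports low (below `l`) at posteriors above `c` and high (above `h`) at the others. His
messages have densities proportional to `(l - m)⁺` and `(m - h)⁺`. The two first-order conditions in
`IsSaddle` say exactly that, after mixing with truthful reports, each low message induces belief `l`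
and each high message belief `h`. Hence his play induces the belief `clamp l h m` after message `m`
(`payoff_saddle`), which bounds every guarantee from above. Responding optimally to the clamped
message attains the bound: the supporting lines at `l` and `h` cross at `c`, so among the lines
supporting at points of `[l, h]` the one at `l` is lowest above `c` and the one at `h` is lowest
below `c`. The adviser thus plays a best response (`payoff_cutoffAdviser_le`).

Uniqueness: an optimal strategy must be Bayes-optimal for `clamp l h m` at almost every `m`, and
under strict convexity a private strategy is Bayes-optimal for at most one belief, so its trust
interval can only be `[l, h]` (`isTrustInterval_iff`).

Existence of the saddle point: each cutoff determines `l` and `h` through the first-order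
conditions, and the intermediate value theorem finds a cutoff at which the lines cross
(`exists_isSaddle`). Monotonicity: if alignment rises and the cutoff moves up, the condition for `l`
pushes `l` down, and the crossing condition then forces `h` up; the other case is symmetric
(`IsSaddle.lt_of_lt`). Continuity follows from uniqueness, compactness and closedness of the saddle
conditions. At `α = 1/2` the two conditions force `l = h`, which is then the mean; at `α = 1` they
force `l = 0` and `h = 1`. -/

namespace TrustRegion

/-! ### Partial moments of a distribution on the unit interval -/

section PartialMoments

variable (τ : Measure unitInterval)

/-- The mean shortfall of the posterior below `x`. -/
noncomputable def shortfall (x : ℝ) : ℝ := ∫ s : unitInterval, max (x - s) 0 ∂τ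

/-- The mean excess of the posterior above `x`. -/
noncomputable def excess (x : ℝ) : ℝ := ∫ s : unitInterval, max ((s : ℝ) - x) 0 ∂τ

/-- The integral of `s - x` over the posteriors above the cutoff `c`. -/
noncomputable def upperGap (c : unitInterval) (x : ℝ) : ℝ :=
  ∫ s : unitInterval, (Ioi c).indicator (fun s => (s : ℝ) - x) s ∂τ

/-- The integral of `x - s` over the posteriors below the cutoff `c`. -/
noncomputable def lowerGap (c : unitInterval) (x : ℝ) : ℝ :=
  ∫ s : unitInterval, (Iic c).indicator (fun s => x - (s : ℝ)) s ∂τ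

variable {τ}

theorem integrable_of_continuous [IsFiniteMeasure τ] {f : unitInterval → ℝ} (hf : Continuous f) :
    Integrable f τ :=
  hf.integrable_of_hasCompactSupport (HasCompactSupport.of_compactSpace f)

theorem integrable_indicator_of_continuous [IsFiniteMeasure τ] {f : unitInterval → ℝ}
    (hf : Continuous f) {S : Set unitInterval} (hS : MeasurableSet S) :
    Integrable (S.indicator f) τ :=
  (integrable_of_continuous hf).indicator hS

/-- Nonempty open sets have positive measure, so strictness on one of them survives integration.
This is how the full support of the posterior enters. -/
theorem integral_lt_of_lt_on_open [τ.IsOpenPosMeasure] {f g : unitInterval → ℝ}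
    (hf : Integrable f τ) (hg : Integrable g τ) (hle : ∀ s, f s ≤ g s)
    {O : Set unitInterval} (hO : IsOpen O) (hne : O.Nonempty) (hlt : ∀ s ∈ O, f s < g s) :
    ∫ s, f s ∂τ < ∫ s, g s ∂τ := by
  rw [← sub_pos, ← integral_sub hg hf]
  refine (integral_pos_iff_support_of_nonneg (fun s => sub_nonneg.2 (hle s)) (hg.sub hf)).2 ?_
  refine (hO.measure_pos τ hne).trans_le (measure_mono fun s hs => ?_)
  exact (sub_pos.2 (hlt s hs)).ne'

theorem continuous_shortfallIntegrand (x : ℝ) :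
    Continuous fun s : unitInterval => max (x - (s : ℝ)) 0 := by fun_prop

theorem continuous_excessIntegrand (x : ℝ) :
    Continuous fun s : unitInterval => max ((s : ℝ) - x) 0 := by fun_prop

theorem exists_coe_between {x y : ℝ} (hx : 0 ≤ x) (hy : y ≤ 1) (h : x < y) :
    ({s : unitInterval | x < s ∧ (s : ℝ) < y} : Set unitInterval).Nonempty :=
  ⟨⟨(x + y) / 2, by constructor <;> linarith⟩, by constructor <;> simp only <;> linarith⟩

theorem isOpen_coe_between (x y : ℝ) :
    IsOpen ({s : unitInterval | x < s ∧ (s : ℝ) < y} : Set unitInterval) :=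
  (isOpen_lt continuous_const continuous_subtype_val).inter
    (isOpen_lt continuous_subtype_val continuous_const)

theorem shortfall_nonneg (x : ℝ) : 0 ≤ shortfall τ x :=
  integral_nonneg fun _ => le_max_right _ _

theorem excess_nonneg (x : ℝ) : 0 ≤ excess τ x :=
  integral_nonneg fun _ => le_max_right _ _

/-- With the pivot at the cutoff, the indicator merely truncates to the positive part. This settles
the first-order conditions in the boundary cases `l = c` and `h = c`. -/
theorem upperGap_self (c : unitInterval) : upperGap τ c c = excess τ c := by
  refine integral_congr_ae (Filter.Eventually.of_forall fun s => ?_)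
  simp only [indicator_apply, mem_Ioi]
  split_ifs with h
  · exact (max_eq_left (sub_nonneg.2 (Subtype.coe_le_coe.2 h.le))).symm
  · exact (max_eq_right (sub_nonpos.2 (Subtype.coe_le_coe.2 (not_lt.1 h)))).symm

theorem lowerGap_self (c : unitInterval) : lowerGap τ c c = shortfall τ c := by
  refine integral_congr_ae (Filter.Eventually.of_forall fun s => ?_)
  simp only [indicator_apply, mem_Iic]
  split_ifs with h
  · exact (max_eq_left (sub_nonneg.2 (Subtype.coe_le_coe.2 h))).symm
  · exact (max_eq_right (sub_nonpos.2 (Subtype.coe_le_coe.2 (not_le.1 h).le))).symm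

theorem upperGap_nonneg {c : unitInterval} {x : ℝ} (hx : x ≤ c) : 0 ≤ upperGap τ c x := by
  refine integral_nonneg fun s => indicator_nonneg (fun s hs => ?_) s
  have : (c : ℝ) < s := hs
  linarith

theorem lowerGap_nonneg {c : unitInterval} {x : ℝ} (hx : (c : ℝ) ≤ x) : 0 ≤ lowerGap τ c x := by
  refine integral_nonneg fun s => indicator_nonneg (fun s hs => ?_) s
  have : (s : ℝ) ≤ c := hs
  linarith

theorem shortfall_zero : shortfall τ 0 = 0 := by
  refine (integral_congr_ae (Filter.Eventually.of_forall fun s => ?_)).trans (integral_zero _ _)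
  exact max_eq_right (by linarith [s.2.1])

theorem excess_one : excess τ 1 = 0 := by
  refine (integral_congr_ae (Filter.Eventually.of_forall fun s => ?_)).trans (integral_zero _ _)
  exact max_eq_right (by linarith [s.2.2])

variable [IsProbabilityMeasure τ]

theorem shortfall_mono : Monotone (shortfall τ) := fun x y h =>
  integral_mono (integrable_of_continuous (continuous_shortfallIntegrand x))
    (integrable_of_continuous (continuous_shortfallIntegrand y))
    fun s => max_le_max (by linarith) le_rfl

theorem excess_anti : Antitone (excess τ) := fun x y h =>
  integral_mono (integrable_of_continuous (continuous_excessIntegrand y))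
    (integrable_of_continuous (continuous_excessIntegrand x))
    fun s => max_le_max (by linarith) le_rfl

/-- Positive part minus negative part. This identity is what brings the prior mean into the
argument. -/
theorem shortfall_sub_excess (x : ℝ) :
    shortfall τ x - excess τ x = x - ∫ s : unitInterval, (s : ℝ) ∂τ := by
  rw [shortfall, excess, ← integral_sub (integrable_of_continuous (by fun_prop))
    (integrable_of_continuous (by fun_prop))]
  have h : ∀ s : unitInterval, max (x - (s : ℝ)) 0 - max ((s : ℝ) - x) 0 = x - s := by
    intro s
    rcases le_total x s with h | h
    · rw [max_eq_right (by linarith), max_eq_left (by linarith)]; ring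
    · rw [max_eq_left (by linarith), max_eq_right (by linarith)]; ring
  simp_rw [h]
  rw [integral_sub (integrable_const _) (integrable_of_continuous (by fun_prop))]
  simp

theorem upperGap_eq (c : unitInterval) (x : ℝ) :
    upperGap τ c x = upperGap τ c 0 - x * τ.real (Ioi c) := by
  have h1 : ∀ s : unitInterval, (Ioi c).indicator (fun s : unitInterval => (s : ℝ) - x) s
      = (Ioi c).indicator (fun s : unitInterval => (s : ℝ) - 0) s - (Ioi c).indicator (fun _ => x) s := by
    intro s; simp only [indicator_apply]; split_ifs <;> ring
  rw [upperGap]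
  simp_rw [h1]
  rw [integral_sub (integrable_indicator_of_continuous (by fun_prop) measurableSet_Ioi)
    (integrable_indicator_of_continuous continuous_const measurableSet_Ioi), upperGap,
    integral_indicator_const _ measurableSet_Ioi, smul_eq_mul, mul_comm]

theorem lowerGap_eq (c : unitInterval) (x : ℝ) :
    lowerGap τ c x = lowerGap τ c 0 + x * τ.real (Iic c) := by
  have h1 : ∀ s : unitInterval, (Iic c).indicator (fun s : unitInterval => x - (s : ℝ)) s
      = (Iic c).indicator (fun s : unitInterval => 0 - (s : ℝ)) s + (Iic c).indicator (fun _ => x) s := by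
    intro s; simp only [indicator_apply]; split_ifs <;> ring
  rw [lowerGap]
  simp_rw [h1]
  rw [integral_add (integrable_indicator_of_continuous (by fun_prop) measurableSet_Iic)
    (integrable_indicator_of_continuous continuous_const measurableSet_Iic), lowerGap,
    integral_indicator_const _ measurableSet_Iic, smul_eq_mul, mul_comm]

theorem upperGap_anti (c : unitInterval) : Antitone (upperGap τ c) := fun x y h => by
  rw [upperGap_eq c x, upperGap_eq c y]
  have := mul_le_mul_of_nonneg_right h (measureReal_nonneg (μ := τ) (s := Ioi c))
  linarith

theorem lowerGap_mono (c : unitInterval) : Monotone (lowerGap τ c) := fun x y h => by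
  rw [lowerGap_eq c x, lowerGap_eq c y]
  have := mul_le_mul_of_nonneg_right h (measureReal_nonneg (μ := τ) (s := Iic c))
  linarith

/-- With the pivot at or below the lower cutoff, raising the cutoff only discards nonnegative mass.
-/
theorem upperGap_anti_cutoff {c c' : unitInterval} {x : ℝ} (hx : x ≤ c) (h : c ≤ c') :
    upperGap τ c' x ≤ upperGap τ c x := by
  refine integral_mono (integrable_indicator_of_continuous (by fun_prop) measurableSet_Ioi)
    (integrable_indicator_of_continuous (by fun_prop) measurableSet_Ioi) fun s => ?_
  simp only [indicator_apply, mem_Ioi]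
  split_ifs with h1 h2 h2
  · exact le_rfl
  · exact absurd (h.trans_lt h1) h2
  · have : (c : ℝ) < s := h2
    linarith
  · exact le_rfl

theorem lowerGap_mono_cutoff {c c' : unitInterval} {x : ℝ} (hx : (c' : ℝ) ≤ x) (h : c ≤ c') :
    lowerGap τ c x ≤ lowerGap τ c' x := by
  refine integral_mono (integrable_indicator_of_continuous (by fun_prop) measurableSet_Iic)
    (integrable_indicator_of_continuous (by fun_prop) measurableSet_Iic) fun s => ?_
  simp only [indicator_apply, mem_Iic]
  split_ifs with h1 h2 h2
  · exact le_rfl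
  · exact absurd (h1.trans h) h2
  · have : (s : ℝ) ≤ c' := h2
    linarith
  · exact le_rfl

theorem lowerGap_eq_add_upperGap (c : unitInterval) (x : ℝ) :
    lowerGap τ c x = x - ∫ s : unitInterval, (s : ℝ) ∂τ + upperGap τ c x := by
  have h1 : ∀ s : unitInterval, (Iic c).indicator (fun s : unitInterval => x - (s : ℝ)) s
      = (x - (s : ℝ)) + (Ioi c).indicator (fun s : unitInterval => (s : ℝ) - x) s := by
    intro s
    by_cases h : s ≤ c
    · simp [h]
    · simp [h, lt_of_not_ge h]
  rw [lowerGap]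
  simp_rw [h1]
  rw [integral_add (integrable_of_continuous (by fun_prop))
    (integrable_indicator_of_continuous (by fun_prop) measurableSet_Ioi),
    integral_sub (integrable_const _) (integrable_of_continuous (by fun_prop)), upperGap]
  simp

theorem continuous_shortfall : Continuous (shortfall τ) := by
  have := continuous_parametric_integral_of_continuous (μ := τ) (s := univ)
    (f := fun (x : ℝ) (s : unitInterval) => max (x - (s : ℝ)) 0) (by fun_prop) isCompact_univ
  simp only [Measure.restrict_univ] at this
  exact this

theorem continuous_excess : Continuous (excess τ) := by
  have := continuous_parametric_integral_of_continuous (μ := τ) (s := univ)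
    (f := fun (x : ℝ) (s : unitInterval) => max ((s : ℝ) - x) 0) (by fun_prop) isCompact_univ
  simp only [Measure.restrict_univ] at this
  exact this

/-- Dominated convergence: as the cutoff tends to `c₀` the integrand converges at every `s ≠ c₀`,
and `c₀` carries no mass. -/
theorem continuous_integral_indicator_Ioi [NullSingletonClass τ] {f : unitInterval → ℝ}
    (hf : Continuous f) : Continuous fun c => ∫ s, (Ioi c).indicator f s ∂τ := by
  refine continuous_iff_continuousAt.2 fun c₀ => ?_
  refine continuousAt_of_dominated (bound := fun s => ‖f s‖)
    (Filter.Eventually.of_forall fun c =>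
      hf.aestronglyMeasurable.indicator measurableSet_Ioi)
    (Filter.Eventually.of_forall fun c => Filter.Eventually.of_forall fun s =>
      norm_indicator_le_norm_self _ _)
    (integrable_of_continuous hf).norm ?_
  have h0 : ∀ᵐ s ∂τ, s ≠ c₀ := by simp [ae_iff]
  filter_upwards [h0] with s hs
  rcases lt_or_gt_of_ne hs with h | h
  · refine (continuousAt_const (y := (0 : ℝ))).congr ?_
    filter_upwards [lt_mem_nhds h] with c hc
    exact (indicator_of_notMem (by simpa using hc.le) _).symm
  · refine (continuousAt_const (y := f s)).congr ?_
    filter_upwards [gt_mem_nhds h] with c hc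
    exact (indicator_of_mem (by simpa using hc) _).symm

theorem continuous_upperGap [NullSingletonClass τ] :
    Continuous fun q : unitInterval × ℝ => upperGap τ q.1 q.2 := by
  have h1 : Continuous fun c : unitInterval => upperGap τ c 0 :=
    continuous_integral_indicator_Ioi (by fun_prop)
  have h2 : Continuous fun c : unitInterval => τ.real (Ioi c) := by
    have := continuous_integral_indicator_Ioi (τ := τ) (f := fun _ => (1 : ℝ)) continuous_const
    simpa [integral_indicator_const _ (measurableSet_Ioi)] using this
  have h3 : (fun q : unitInterval × ℝ => upperGap τ q.1 q.2) =
      fun q => upperGap τ q.1 0 - q.2 * τ.real (Ioi q.1) := funext fun q => upperGap_eq q.1 q.2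
  rw [h3]
  exact (h1.comp continuous_fst).sub (continuous_snd.mul (h2.comp continuous_fst))

theorem continuous_lowerGap [NullSingletonClass τ] :
    Continuous fun q : unitInterval × ℝ => lowerGap τ q.1 q.2 := by
  simp_rw [lowerGap_eq_add_upperGap]
  exact (continuous_snd.sub continuous_const).add continuous_upperGap

section OpenPos

variable [τ.IsOpenPosMeasure]

theorem shortfall_lt {x y : ℝ} (hx : 0 ≤ x) (hy : y ≤ 1) (h : x < y) :
    shortfall τ x < shortfall τ y :=
  integral_lt_of_lt_on_open (integrable_of_continuous (by fun_prop))
    (integrable_of_continuous (by fun_prop)) (fun s => max_le_max (by linarith) le_rfl)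
    (isOpen_coe_between x y) (exists_coe_between hx hy h) fun s hs => by
      rw [max_eq_right (by linarith [hs.1]), max_eq_left (by linarith [hs.2])]
      linarith [hs.2]

theorem excess_lt {x y : ℝ} (hx : 0 ≤ x) (hy : y ≤ 1) (h : x < y) :
    excess τ y < excess τ x :=
  integral_lt_of_lt_on_open (integrable_of_continuous (by fun_prop))
    (integrable_of_continuous (by fun_prop)) (fun s => max_le_max (by linarith) le_rfl)
    (isOpen_coe_between x y) (exists_coe_between hx hy h) fun s hs => by
      rw [max_eq_right (by linarith [hs.2]), max_eq_left (by linarith [hs.1])]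
      linarith [hs.1]

theorem shortfall_pos {x : ℝ} (hx : 0 < x) (hx1 : x ≤ 1) : 0 < shortfall τ x :=
  shortfall_zero.symm.trans_lt (shortfall_lt (τ := τ) le_rfl hx1 hx)

theorem excess_pos {x : ℝ} (hx : 0 ≤ x) (hx1 : x < 1) : 0 < excess τ x :=
  excess_one.symm.trans_lt (excess_lt (τ := τ) hx le_rfl hx1)

theorem upperGap_pos {c : unitInterval} {x : ℝ} (hx : x ≤ c) (hc : (c : ℝ) < 1) :
    0 < upperGap τ c x :=
  (excess_pos c.2.1 hc).trans_le ((upperGap_self c).symm.trans_le (upperGap_anti c hx))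

theorem lowerGap_pos {c : unitInterval} {x : ℝ} (hx : (c : ℝ) ≤ x) (hc : 0 < (c : ℝ)) :
    0 < lowerGap τ c x :=
  (shortfall_pos hc c.2.2).trans_le ((lowerGap_self c).symm.trans_le (lowerGap_mono c hx))

end OpenPos

end PartialMoments

/-! ### Supporting lines of a strictly convex function -/

section Subgradient

/-- `k` is the slope of a line that supports `V` at `p` on the unit interval. -/
def IsSubgradient (V : ℝ → ℝ) (p k : ℝ) : Prop :=
  ∀ s ∈ Icc (0 : ℝ) 1, V p + k * (s - p) ≤ V s

variable {V : ℝ → ℝ} {p q k k' s : ℝ}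

/-- Adding the two support inequalities, each tested at the other contact point, gives `(k' - k) *
(q - p) ≥ 0`. -/
theorem IsSubgradient.slope_le (hk : IsSubgradient V p k) (hk' : IsSubgradient V q k')
    (hp : p ∈ Icc (0 : ℝ) 1) (hq : q ∈ Icc (0 : ℝ) 1) (hpq : p < q) : k ≤ k' := by
  have h1 := hk q hq
  have h2 := hk' p hp
  by_contra! h
  nlinarith

/-- At the midpoint of `p` and `q` the line is at most `V`, which is strictly below the chord;
contact at `q` would contradict this. -/
theorem IsSubgradient.lt (hV : StrictConvexOn ℝ (Icc (0 : ℝ) 1) V) (hk : IsSubgradient V p k)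
    (hp : p ∈ Icc (0 : ℝ) 1) (hq : q ∈ Icc (0 : ℝ) 1) (hpq : p ≠ q) :
    V p + k * (q - p) < V q := by
  have h1 := hV.2 hp hq hpq (show (0 : ℝ) < 1 / 2 by norm_num)
    (show (0 : ℝ) < 1 / 2 by norm_num) (by norm_num)
  have h2 := hk (1 / 2 * p + 1 / 2 * q)
    ⟨by linarith [hp.1, hq.1], by linarith [hp.2, hq.2]⟩
  simp only [smul_eq_mul] at h1
  nlinarith

/-- To the right of both contact points, the supporting line further right is higher. -/
theorem IsSubgradient.line_le_right (hk : IsSubgradient V p k) (hk' : IsSubgradient V q k')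
    (hp : p ∈ Icc (0 : ℝ) 1) (hq : q ∈ Icc (0 : ℝ) 1) (hpq : p < q) (hs : q ≤ s) :
    V p + k * (s - p) ≤ V q + k' * (s - q) := by
  have h1 := hk q hq
  have h2 := mul_le_mul_of_nonneg_right (hk.slope_le hk' hp hq hpq) (sub_nonneg.2 hs)
  nlinarith

theorem IsSubgradient.line_le_left (hk : IsSubgradient V p k) (hk' : IsSubgradient V q k')
    (hp : p ∈ Icc (0 : ℝ) 1) (hq : q ∈ Icc (0 : ℝ) 1) (hpq : p < q) (hs : s ≤ p) :
    V q + k' * (s - q) ≤ V p + k * (s - p) := by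
  have h1 := hk' p hp
  have h2 := mul_le_mul_of_nonneg_right (hk.slope_le hk' hp hq hpq) (sub_nonneg.2 hs)
  nlinarith

theorem IsSubgradient.line_lt_right (hV : StrictConvexOn ℝ (Icc (0 : ℝ) 1) V)
    (hk : IsSubgradient V p k) (hk' : IsSubgradient V q k')
    (hp : p ∈ Icc (0 : ℝ) 1) (hq : q ∈ Icc (0 : ℝ) 1) (hpq : p < q) (hs : q ≤ s) :
    V p + k * (s - p) < V q + k' * (s - q) := by
  have h1 := hk.lt hV hp hq hpq.ne
  have h2 := mul_le_mul_of_nonneg_right (hk.slope_le hk' hp hq hpq) (sub_nonneg.2 hs)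
  nlinarith

theorem IsSubgradient.line_lt_left (hV : StrictConvexOn ℝ (Icc (0 : ℝ) 1) V)
    (hk : IsSubgradient V p k) (hk' : IsSubgradient V q k')
    (hp : p ∈ Icc (0 : ℝ) 1) (hq : q ∈ Icc (0 : ℝ) 1) (hpq : p < q) (hs : s ≤ p) :
    V q + k' * (s - q) < V p + k * (s - p) := by
  have h1 := hk'.lt hV hq hp hpq.ne'
  have h2 := mul_le_mul_of_nonneg_right (hk.slope_le hk' hp hq hpq) (sub_nonneg.2 hs)
  nlinarith

/-- `V` minus the line has an interior minimum at `p`. Supporting slopes are therefore unique at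
interior points. -/
theorem IsSubgradient.eq_deriv (hk : IsSubgradient V p k) (hp : p ∈ Ioo (0 : ℝ) 1)
    (hd : DifferentiableAt ℝ V p) : k = deriv V p := by
  have hmin : IsLocalMin (fun s => V s - k * (s - p)) p := by
    filter_upwards [Ioo_mem_nhds hp.1 hp.2] with s hs
    have := hk s ⟨hs.1.le, hs.2.le⟩
    simp only [sub_self, mul_zero, sub_zero]
    linarith
  have hder : HasDerivAt (fun s => V s - k * (s - p)) (deriv V p - k * 1) p :=
    hd.hasDerivAt.sub (((hasDerivAt_id p).sub_const p).const_mul k)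
  have := hmin.hasDerivAt_eq_zero hder
  linarith

end Subgradient

/-! ### The saddle point conditions -/

/-- The first-order conditions for trust bounds `l`, `h` against an adviser who reports low
exactly at the posteriors above the cutoff `c`, together with the condition that the supporting
lines of `V` at `l` and `h` cross at `c`. -/
structure IsSaddle (τ : Measure unitInterval) (V : ℝ → ℝ) (K α : ℝ) (l h c : unitInterval)
    (k₁ k₂ : ℝ) : Prop where
  left_le : l ≤ c
  le_right : c ≤ h
  low : α * shortfall τ l = (1 - α) * upperGap τ c l
  high : α * excess τ h = (1 - α) * lowerGap τ c h
  abs_le₁ : |k₁| ≤ K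
  abs_le₂ : |k₂| ≤ K
  subgradient₁ : IsSubgradient V l k₁
  subgradient₂ : IsSubgradient V h k₂
  cross : V l + k₁ * (c - l) = V h + k₂ * (c - h)

section Saddle

variable {τ : Measure unitInterval} [IsProbabilityMeasure τ] [τ.IsOpenPosMeasure]
  {V : ℝ → ℝ} {K α α' : ℝ} {l h c l' h' c' : unitInterval} {k₁ k₂ k₁' k₂' : ℝ}

theorem eq_zero_of_shortfall_nonpos (hx : shortfall τ l ≤ 0) : l = 0 := by
  by_contra hl
  exact hx.not_gt (shortfall_pos (unitInterval.pos_iff_ne_zero.2 hl) l.2.2)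

theorem eq_one_of_excess_nonpos (hx : excess τ l ≤ 0) : l = 1 := by
  by_contra hl
  exact hx.not_gt (excess_pos l.2.1 (unitInterval.lt_one_iff_ne_one.2 hl))

theorem IsSaddle.eq_of_one (H : IsSaddle τ V K 1 l h c k₁ k₂) : l = 0 ∧ h = 1 := by
  have h1 := H.low
  have h2 := H.high
  simp only [one_mul, sub_self, zero_mul] at h1 h2
  exact ⟨eq_zero_of_shortfall_nonpos h1.le, eq_one_of_excess_nonpos h2.le⟩

theorem low_pos (hα : α < 1) (hlow : α * shortfall τ l = (1 - α) * upperGap τ c l)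
    (hc : (c : ℝ) < 1) : 0 < (l : ℝ) := by
  by_contra! hl
  have hl0 : (l : ℝ) = 0 := le_antisymm hl l.2.1
  rw [hl0, shortfall_zero, mul_zero] at hlow
  have := mul_pos (sub_pos.2 hα) (upperGap_pos (τ := τ) (x := 0) c.2.1 hc)
  linarith

theorem high_lt (hα : α < 1) (hhigh : α * excess τ h = (1 - α) * lowerGap τ c h)
    (hc : 0 < (c : ℝ)) : (h : ℝ) < 1 := by
  by_contra! hl
  have hl0 : (h : ℝ) = 1 := le_antisymm h.2.2 hl
  rw [hl0, excess_one, mul_zero] at hhigh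
  have := mul_pos (sub_pos.2 hα) (lowerGap_pos (τ := τ) (x := 1) c.2.2 hc)
  linarith

/-- If `l = 0`, the low condition forces `c = 1`, hence `h = 1`; but then the high condition forces
`h < 1`. -/
theorem IsSaddle.pos (H : IsSaddle τ V K α l h c k₁ k₂) (hα : α < 1) : 0 < (l : ℝ) := by
  have hlc : (l : ℝ) ≤ c := H.left_le
  have hch : (c : ℝ) ≤ h := H.le_right
  by_contra! hl
  have hc : ¬ (c : ℝ) < 1 := fun hc => hl.not_gt (low_pos hα H.low hc)
  have := high_lt hα H.high (by linarith)
  linarith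

theorem IsSaddle.lt_one (H : IsSaddle τ V K α l h c k₁ k₂) (hα : α < 1) : (h : ℝ) < 1 := by
  have hlc : (l : ℝ) ≤ c := H.left_le
  exact high_lt hα H.high (by linarith [H.pos hα])

theorem IsSaddle.mem_Ioo_left (H : IsSaddle τ V K α l h c k₁ k₂) (hα : α < 1) :
    (l : ℝ) ∈ Ioo (0 : ℝ) 1 :=
  ⟨H.pos hα, lt_of_le_of_lt (Subtype.coe_le_coe.2 (H.left_le.trans H.le_right)) (H.lt_one hα)⟩

theorem IsSaddle.mem_Ioo_right (H : IsSaddle τ V K α l h c k₁ k₂) (hα : α < 1) :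
    (h : ℝ) ∈ Ioo (0 : ℝ) 1 :=
  ⟨(H.pos hα).trans_le (Subtype.coe_le_coe.2 (H.left_le.trans H.le_right)), H.lt_one hα⟩

/-- At `α = 1/2` the conditions give `shortfall l + excess h = upperGap c l + lowerGap c h`. The
integrand on the right dominates the one on the left, strictly on `(l, h)`, so this interval is
empty. Then `c = l = h` and shortfall equals excess there. -/
theorem IsSaddle.eq_mean (H : IsSaddle τ V K (1 / 2) l h c k₁ k₂) :
    (l : ℝ) = ∫ s : unitInterval, (s : ℝ) ∂τ ∧ (h : ℝ) = ∫ s : unitInterval, (s : ℝ) ∂τ := by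
  have hl : shortfall τ l = upperGap τ c l := by linarith [H.low]
  have hh : excess τ h = lowerGap τ c h := by linarith [H.high]
  have hlc : (l : ℝ) ≤ c := H.left_le
  have hch : (c : ℝ) ≤ h := H.le_right
  have key : (l : ℝ) = h := by
    by_contra hne
    have hlt : (l : ℝ) < h := lt_of_le_of_ne (hlc.trans hch) hne
    -- The integrals of `f` and `g` are shortfall minus `lowerGap` and `upperGap` minus excess,
    -- which the conditions make equal.
    have := integral_lt_of_lt_on_open (τ := τ)
      (f := fun s : unitInterval => max ((l : ℝ) - s) 0 +
        (Iic c).indicator (fun s : unitInterval => -((h : ℝ) - s)) s)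
      (g := fun s : unitInterval => (Ioi c).indicator (fun s : unitInterval => (s : ℝ) - l) s +
        -max ((s : ℝ) - h) 0)
      ((integrable_of_continuous (by fun_prop)).add
        (integrable_indicator_of_continuous (by fun_prop) measurableSet_Iic))
      ((integrable_indicator_of_continuous (by fun_prop) measurableSet_Ioi).add
        (integrable_of_continuous (by fun_prop))) ?_
      (isOpen_coe_between l h) (exists_coe_between l.2.1 h.2.2 hlt) ?_
    · rw [integral_add (integrable_of_continuous (by fun_prop))
        (integrable_indicator_of_continuous (by fun_prop) measurableSet_Iic),
        integral_add (integrable_indicator_of_continuous (by fun_prop) measurableSet_Ioi)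
        (integrable_of_continuous (by fun_prop)), integral_neg] at this
      have e : ∫ s, (Iic c).indicator (fun s : unitInterval => -((h : ℝ) - s)) s ∂τ
          = -lowerGap τ c h := by
        rw [lowerGap, ← integral_neg]
        congr 1
        ext s
        simp only [indicator_apply]
        split_ifs <;> simp
      rw [e] at this
      simp only [shortfall, excess, upperGap] at hl hh
      linarith
    · intro s
      by_cases hs : s ≤ c
      · have h1 : (s : ℝ) ≤ c := hs
        rw [indicator_of_mem (by exact hs), indicator_of_notMem (by simpa using hs),
          max_eq_right (by linarith : (s : ℝ) - h ≤ 0)]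
        rcases max_cases ((l : ℝ) - s) 0 with h2 | h2 <;> linarith
      · have h1 : (c : ℝ) < s := not_le.1 hs
        rw [indicator_of_notMem (by exact hs), indicator_of_mem (by simpa using hs),
          max_eq_right (by linarith : (l : ℝ) - s ≤ 0)]
        rcases max_cases ((s : ℝ) - h) 0 with h2 | h2 <;> linarith
    · rintro s ⟨h1, h2⟩
      rw [max_eq_right (by linarith : (s : ℝ) - h ≤ 0), max_eq_right (by linarith : (l : ℝ) - s ≤ 0)]
      by_cases hs : s ≤ c
      · rw [indicator_of_mem (by exact hs), indicator_of_notMem (by simpa using hs)]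
        linarith
      · rw [indicator_of_notMem (by exact hs), indicator_of_mem (by simpa using hs)]
        linarith
  have hcl : c = l := Subtype.ext (by linarith)
  have hm := shortfall_sub_excess (τ := τ) l
  rw [hcl, upperGap_self] at hl
  constructor <;> linarith

/-- If `l ≤ l'`, the left side of the low condition would have risen strictly, while its right side
could only have fallen: its weight `1 - α` is smaller and its cutoff and pivot are larger. -/
theorem IsSaddle.low_lt_of_le (H : IsSaddle τ V K α l h c k₁ k₂)
    (H' : IsSaddle τ V K α' l' h' c' k₁' k₂') (h0 : 0 ≤ α) (hαα : α < α') (h1 : α' ≤ 1)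
    (hc : c ≤ c') : (l' : ℝ) < l := by
  by_contra! hl
  have hpos := shortfall_pos (τ := τ) (H.pos (hαα.trans_le h1)) l.2.2
  have e1 := mul_le_mul_of_nonneg_left (shortfall_mono (τ := τ) hl) (h0.trans hαα.le)
  have e2 := mul_le_mul_of_nonneg_left
    ((upperGap_anti (τ := τ) c' hl).trans (upperGap_anti_cutoff (Subtype.coe_le_coe.2 H.left_le) hc))
    (sub_nonneg.2 h1)
  have e3 := upperGap_nonneg (τ := τ) (Subtype.coe_le_coe.2 H.left_le)
  have e4 := H.low
  have e5 := H'.low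
  nlinarith [mul_pos (sub_pos.2 hαα) hpos, mul_nonneg (sub_pos.2 hαα).le e3]

theorem IsSaddle.high_gt_of_le (H : IsSaddle τ V K α l h c k₁ k₂)
    (H' : IsSaddle τ V K α' l' h' c' k₁' k₂') (h0 : 0 ≤ α) (hαα : α < α') (h1 : α' ≤ 1)
    (hc : c' ≤ c) : (h : ℝ) < h' := by
  by_contra! hl
  have hpos := excess_pos (τ := τ) h.2.1 (H.lt_one (hαα.trans_le h1))
  have e1 := mul_le_mul_of_nonneg_left (excess_anti (τ := τ) hl) (h0.trans hαα.le)
  have e2 := mul_le_mul_of_nonneg_left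
    ((lowerGap_mono (τ := τ) c' hl).trans (lowerGap_mono_cutoff (Subtype.coe_le_coe.2 H.le_right) hc))
    (sub_nonneg.2 h1)
  have e3 := lowerGap_nonneg (τ := τ) (Subtype.coe_le_coe.2 H.le_right)
  have e4 := H.high
  have e5 := H'.high
  nlinarith [mul_pos (sub_pos.2 hαα) hpos, mul_nonneg (sub_pos.2 hαα).le e3]

/-- A more aligned adviser is trusted on a larger interval. -/
theorem IsSaddle.lt_of_lt (hV : StrictConvexOn ℝ (Icc (0 : ℝ) 1) V)
    (hd : DifferentiableOn ℝ V (Ioo (0 : ℝ) 1)) (H : IsSaddle τ V K α l h c k₁ k₂)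
    (H' : IsSaddle τ V K α' l' h' c' k₁' k₂') (h0 : 0 ≤ α) (hαα : α < α') (h1 : α' ≤ 1) :
    (l' : ℝ) < l ∧ (h : ℝ) < h' := by
  have hα : α < 1 := hαα.trans_le h1
  have hlc : (l : ℝ) ≤ c := H.left_le
  have hch : (c : ℝ) ≤ h := H.le_right
  have hlc' : (l' : ℝ) ≤ c' := H'.left_le
  have hch' : (c' : ℝ) ≤ h' := H'.le_right
  rcases h1.eq_or_lt with rfl | h1
  · obtain ⟨rfl, rfl⟩ := H'.eq_of_one
    exact ⟨H.pos hα, H.lt_one hα⟩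
  have unique : ∀ {p : unitInterval} {k k' : ℝ}, (p : ℝ) ∈ Ioo (0 : ℝ) 1 →
      IsSubgradient V p k → IsSubgradient V p k' → k = k' := fun hp hk hk' => by
    have hdp := hd.differentiableAt (Ioo_mem_nhds hp.1 hp.2)
    rw [hk.eq_deriv hp hdp, hk'.eq_deriv hp hdp]
  have hcross := H.cross
  have hcross' := H'.cross
  rcases le_total c c' with hc | hc
  · have hl := H.low_lt_of_le H' h0 hαα h1.le hc
    refine ⟨hl, ?_⟩
    -- If `h' ≤ h`, then at `c'` the line at `l'` lies strictly below the line at `l`, which is at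
    -- most the line at `h` because `c ≤ c'`, which is at most the line at `h'`. This contradicts
    -- the crossing at `c'`.
    by_contra! hh
    have hcc : (c : ℝ) ≤ c' := hc
    have e1 : V h + k₂ * (c' - h) ≤ V h' + k₂' * (c' - h') := by
      rcases hh.eq_or_lt with e | hlt
      · have e' : h' = h := Subtype.ext e
        subst e'
        rw [unique (H.mem_Ioo_right hα) H.subgradient₂ H'.subgradient₂]
      · exact H'.subgradient₂.line_le_left H.subgradient₂ h'.2 h.2 hlt hch'
    have e2 : k₁ * (c' - c) ≤ k₂ * (c' - c) := by
      rcases hcc.eq_or_lt with e | hlt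
      · rw [e]; simp
      · exact mul_le_mul_of_nonneg_right
          (H.subgradient₁.slope_le H.subgradient₂ l.2 h.2 (by linarith)) (by linarith)
    have e3 := H'.subgradient₁.line_lt_right hV H.subgradient₁ l'.2 l.2 hl (hlc.trans hcc)
    linarith
  · have hl := H.high_gt_of_le H' h0 hαα h1.le hc
    refine ⟨?_, hl⟩
    -- Mirror image: for `c' ≤ c`, the lines are again compared at `c'`.
    by_contra! hh
    have hcc : (c' : ℝ) ≤ c := hc
    have e1 : V l + k₁ * (c' - l) ≤ V l' + k₁' * (c' - l') := by
      rcases hh.eq_or_lt with e | hlt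
      · have e' : l = l' := Subtype.ext e
        subst e'
        rw [unique (H.mem_Ioo_left hα) H.subgradient₁ H'.subgradient₁]
      · exact H.subgradient₁.line_le_right H'.subgradient₁ l.2 l'.2 hlt hlc'
    have e2 : k₁ * (c - c') ≤ k₂ * (c - c') := by
      rcases hcc.eq_or_lt with e | hlt
      · rw [e]; simp
      · exact mul_le_mul_of_nonneg_right
          (H.subgradient₁.slope_le H.subgradient₂ l.2 h.2 (by linarith)) (by linarith)
    have e3 := H.subgradient₂.line_lt_left hV H'.subgradient₂ h.2 h'.2 hl (hcc.trans hch)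
    linarith

theorem isClosed_isSubgradient (hVc : Continuous fun s : unitInterval => V s) :
    IsClosed {q : unitInterval × ℝ | IsSubgradient V q.1 q.2} := by
  simp only [IsSubgradient, ofPred_forall]
  refine isClosed_biInter fun s _ => isClosed_le ?_ continuous_const
  exact (hVc.comp continuous_fst).add (by fun_prop)

-- Every condition is closed. Confining the slopes to `[-K, K]` lets the auxiliary data `(c, k₁,
-- k₂)` range over a compact space, so that they can be projected away.
omit [τ.IsOpenPosMeasure] in
theorem isClosed_isSaddle [NullSingletonClass τ] (hVc : Continuous fun s : unitInterval => V s) :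
    IsClosed {q : (ℝ × unitInterval × unitInterval) × unitInterval × Icc (-K) K × Icc (-K) K |
      IsSaddle τ V K q.1.1 q.1.2.1 q.1.2.2 q.2.1 q.2.2.1 q.2.2.2} := by
  have hs : Continuous (shortfall τ) := continuous_shortfall
  have he : Continuous (excess τ) := continuous_excess
  have hu : Continuous fun q : unitInterval × ℝ => upperGap τ q.1 q.2 := continuous_upperGap
  have hl : Continuous fun q : unitInterval × ℝ => lowerGap τ q.1 q.2 := continuous_lowerGap
  have key : {q : (ℝ × unitInterval × unitInterval) × unitInterval × Icc (-K) K × Icc (-K) K |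
      IsSaddle τ V K q.1.1 q.1.2.1 q.1.2.2 q.2.1 q.2.2.1 q.2.2.2} =
      {q | q.1.2.1 ≤ q.2.1} ∩ ({q | q.2.1 ≤ q.1.2.2} ∩
      ({q | q.1.1 * shortfall τ q.1.2.1 = (1 - q.1.1) * upperGap τ q.2.1 q.1.2.1} ∩
      ({q | q.1.1 * excess τ q.1.2.2 = (1 - q.1.1) * lowerGap τ q.2.1 q.1.2.2} ∩
      ({q | IsSubgradient V q.1.2.1 q.2.2.1} ∩ ({q | IsSubgradient V q.1.2.2 q.2.2.2} ∩
      {q | V q.1.2.1 + q.2.2.1 * (q.2.1 - q.1.2.1) = V q.1.2.2 + q.2.2.2 * (q.2.1 - q.1.2.2)}))))) := by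
    ext q
    constructor
    · rintro ⟨h1, h2, h3, h4, -, -, h7, h8, h9⟩
      exact ⟨h1, h2, h3, h4, h7, h8, h9⟩
    · rintro ⟨h1, h2, h3, h4, h7, h8, h9⟩
      exact ⟨h1, h2, h3, h4, abs_le.2 q.2.2.1.2, abs_le.2 q.2.2.2.2, h7, h8, h9⟩
  rw [key]
  refine (isClosed_le (by fun_prop) (by fun_prop)).inter
    ((isClosed_le (by fun_prop) (by fun_prop)).inter
    ((isClosed_eq ?_ ?_).inter ((isClosed_eq ?_ ?_).inter (IsClosed.inter ?_ (IsClosed.inter ?_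
    (isClosed_eq ?_ ?_))))))
  · exact continuous_fst.fst.mul (hs.comp (by fun_prop))
  · exact (continuous_const.sub continuous_fst.fst).mul
      (hu.comp (g := fun q : unitInterval × ℝ => upperGap τ q.1 q.2)
        (f := fun q : (ℝ × unitInterval × unitInterval) × unitInterval × Icc (-K) K × Icc (-K) K =>
          (q.2.1, (q.1.2.1 : ℝ))) (by fun_prop))
  · exact continuous_fst.fst.mul (he.comp (by fun_prop))
  · exact (continuous_const.sub continuous_fst.fst).mul
      (hl.comp (g := fun q : unitInterval × ℝ => lowerGap τ q.1 q.2)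
        (f := fun q : (ℝ × unitInterval × unitInterval) × unitInterval × Icc (-K) K × Icc (-K) K =>
          (q.2.1, (q.1.2.2 : ℝ))) (by fun_prop))
  · exact (isClosed_isSubgradient hVc).preimage
      (f := fun q : (ℝ × unitInterval × unitInterval) × unitInterval × Icc (-K) K × Icc (-K) K =>
        (q.1.2.1, (q.2.2.1 : ℝ))) (by fun_prop)
  · exact (isClosed_isSubgradient hVc).preimage
      (f := fun q : (ℝ × unitInterval × unitInterval) × unitInterval × Icc (-K) K × Icc (-K) K =>
        (q.1.2.2, (q.2.2.2 : ℝ))) (by fun_prop)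
  · exact (hVc.comp continuous_fst.snd.fst).add (by fun_prop)
  · exact (hVc.comp continuous_fst.snd.snd).add (by fun_prop)

/-- The preimage of a closed set is the projection of a closed set along a compact factor. -/
theorem continuous_of_isClosed_graph {X Y : Type*} [TopologicalSpace X] [TopologicalSpace Y]
    [CompactSpace Y] {f : X → Y} (hf : IsClosed {q : X × Y | f q.1 = q.2}) : Continuous f := by
  refine continuous_iff_isClosed.2 fun C hC => ?_
  convert isClosedMap_fst_of_compactSpace _ (hf.inter (hC.preimage continuous_snd))
  ext x
  simp

omit [τ.IsOpenPosMeasure] in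
/-- Trust bounds that solve the saddle point conditions, and are determined by them, depend
continuously on the alignment. -/
theorem continuousOn_of_isSaddle [NullSingletonClass τ]
    (hVc : Continuous fun s : unitInterval => V s) {S : Set ℝ} {lo hi : ℝ → unitInterval}
    (hex : ∀ α ∈ S, ∃ c k₁ k₂, IsSaddle τ V K α (lo α) (hi α) c k₁ k₂)
    (huniq : ∀ α ∈ S, ∀ l h c k₁ k₂, IsSaddle τ V K α l h c k₁ k₂ → l = lo α ∧ h = hi α) :
    ContinuousOn lo S ∧ ContinuousOn hi S := by
  have hcl := isClosedMap_fst_of_compactSpace _ (isClosed_isSaddle (τ := τ) (K := K) hVc)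
  have hcont : Continuous fun x : S => (lo x, hi x) := by
    refine continuous_of_isClosed_graph ?_
    convert hcl.preimage (f := fun q : S × unitInterval × unitInterval => ((q.1 : ℝ), q.2))
      (by fun_prop) using 1
    ext ⟨x, l, h⟩
    simp only [mem_ofPred_eq, mem_preimage, mem_image, Prod.mk.injEq, Prod.exists]
    constructor
    · rintro ⟨rfl, rfl⟩
      obtain ⟨c, k₁, k₂, H⟩ := hex x x.2
      exact ⟨x, lo x, hi x, c, ⟨k₁, abs_le.1 H.abs_le₁⟩, ⟨k₂, abs_le.1 H.abs_le₂⟩, H, rfl, rfl, rfl⟩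
    · rintro ⟨_, _, _, c, k₁, k₂, H, rfl, rfl, rfl⟩
      exact ((huniq x x.2 _ _ _ _ _ H).imp Eq.symm Eq.symm)
  exact ⟨continuousOn_iff_continuous_domRestrict.2 hcont.fst,
    continuousOn_iff_continuous_domRestrict.2 hcont.snd⟩

end Saddle

/-! ### Existence of a saddle point. -/

section Existence

variable {τ : Measure unitInterval} [IsProbabilityMeasure τ] [τ.IsOpenPosMeasure]
  [NullSingletonClass τ] {V : ℝ → ℝ} {K α : ℝ}

/-- The difference of the two sides is strictly increasing in the bound and changes sign on `[0,
1]`. Its unique root has a closed graph in `c`, hence is continuous, and it is at most `c` when the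
difference is nonnegative at `c`. -/
theorem exists_low (hα : α ∈ Icc (1 / 2 : ℝ) 1) : ∃ f : unitInterval → unitInterval,
    Continuous f ∧ (∀ c, α * shortfall τ (f c) = (1 - α) * upperGap τ c (f c)) ∧
      ∀ c : unitInterval, (1 - α) * excess τ c ≤ α * shortfall τ c → f c ≤ c := by
  have h1 : 0 ≤ 1 - α := sub_nonneg.2 hα.2
  have h0 : 0 < α := by linarith [hα.1]
  have hs : Continuous (shortfall τ) := continuous_shortfall
  have hu : Continuous fun q : unitInterval × ℝ => upperGap τ q.1 q.2 := continuous_upperGap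
  have hmono : ∀ (c : unitInterval) {x y : unitInterval}, x < y →
      α * shortfall τ x - (1 - α) * upperGap τ c x < α * shortfall τ y - (1 - α) * upperGap τ c y := by
    intro c x y hxy
    have e1 := mul_lt_mul_of_pos_left (shortfall_lt (τ := τ) x.2.1 y.2.2 hxy) h0
    have e2 := mul_le_mul_of_nonneg_left
      (upperGap_anti (τ := τ) c (Subtype.coe_le_coe.2 hxy.le)) h1
    linarith
  have hex : ∀ c : unitInterval, ∃ x : unitInterval,
      α * shortfall τ x = (1 - α) * upperGap τ c x := by
    intro c
    obtain ⟨x, -, hx⟩ := isPreconnected_univ.intermediate_value₂ (mem_univ (0 : unitInterval))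
      (mem_univ (1 : unitInterval)) (f := fun x : unitInterval => α * shortfall τ x)
      (g := fun x : unitInterval => (1 - α) * upperGap τ c x)
      (by fun_prop)
      (continuous_const.mul (hu.comp (f := fun x : unitInterval => (c, (x : ℝ)))
        (by fun_prop))).continuousOn
      (by
        simp only [Icc.coe_zero, shortfall_zero, mul_zero]
        exact mul_nonneg h1 (upperGap_nonneg c.2.1))
      (by
        have e : upperGap τ c (1 : unitInterval) ≤ 0 := integral_nonpos fun s =>
          indicator_nonpos (fun s _ => sub_nonpos.2 s.2.2) s
        exact (mul_nonpos_of_nonneg_of_nonpos h1 e).trans (mul_nonneg h0.le (shortfall_nonneg _)))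
    exact ⟨x, hx⟩
  choose f hf using hex
  refine ⟨f, continuous_of_isClosed_graph ?_, hf, fun c hc => ?_⟩
  · have : {q : unitInterval × unitInterval | f q.1 = q.2} =
        {q | α * shortfall τ q.2 = (1 - α) * upperGap τ q.1 q.2} := by
      ext ⟨c, x⟩
      simp only [mem_ofPred_eq]
      constructor
      · rintro rfl
        exact hf c
      · intro hx
        rcases lt_trichotomy (f c) x with h | h | h
        · linarith [hmono c h, hf c]
        · exact h
        · linarith [hmono c h, hf c]
    rw [this]
    exact isClosed_eq (by fun_prop) (continuous_const.mul
      (hu.comp (f := fun q : unitInterval × unitInterval => (q.1, (q.2 : ℝ))) (by fun_prop)))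
  · by_contra! h
    have := hmono c h
    rw [upperGap_self] at this
    linarith [hf c]

theorem exists_high (hα : α ∈ Icc (1 / 2 : ℝ) 1) : ∃ f : unitInterval → unitInterval,
    Continuous f ∧ (∀ c, α * excess τ (f c) = (1 - α) * lowerGap τ c (f c)) ∧
      ∀ c : unitInterval, (1 - α) * shortfall τ c ≤ α * excess τ c → c ≤ f c := by
  have h1 : 0 ≤ 1 - α := sub_nonneg.2 hα.2
  have h0 : 0 < α := by linarith [hα.1]
  have hs : Continuous (excess τ) := continuous_excess
  have hu : Continuous fun q : unitInterval × ℝ => lowerGap τ q.1 q.2 := continuous_lowerGap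
  have hmono : ∀ (c : unitInterval) {x y : unitInterval}, x < y →
      α * excess τ y - (1 - α) * lowerGap τ c y < α * excess τ x - (1 - α) * lowerGap τ c x := by
    intro c x y hxy
    have e1 := mul_lt_mul_of_pos_left (excess_lt (τ := τ) x.2.1 y.2.2 hxy) h0
    have e2 := mul_le_mul_of_nonneg_left
      (lowerGap_mono (τ := τ) c (Subtype.coe_le_coe.2 hxy.le)) h1
    linarith
  have hex : ∀ c : unitInterval, ∃ x : unitInterval,
      α * excess τ x = (1 - α) * lowerGap τ c x := by
    intro c
    obtain ⟨x, -, hx⟩ := isPreconnected_univ.intermediate_value₂ (mem_univ (1 : unitInterval))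
      (mem_univ (0 : unitInterval)) (f := fun x : unitInterval => α * excess τ x)
      (g := fun x : unitInterval => (1 - α) * lowerGap τ c x)
      (by fun_prop)
      (continuous_const.mul (hu.comp (f := fun x : unitInterval => (c, (x : ℝ)))
        (by fun_prop))).continuousOn
      (by
        simp only [Icc.coe_one, excess_one, mul_zero]
        exact mul_nonneg h1 (lowerGap_nonneg c.2.2))
      (by
        have e : lowerGap τ c (0 : unitInterval) ≤ 0 := integral_nonpos fun s =>
          indicator_nonpos (fun s _ => sub_nonpos.2 s.2.1) s
        exact (mul_nonpos_of_nonneg_of_nonpos h1 e).trans (mul_nonneg h0.le (excess_nonneg _)))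
    exact ⟨x, hx⟩
  choose f hf using hex
  refine ⟨f, continuous_of_isClosed_graph ?_, hf, fun c hc => ?_⟩
  · have : {q : unitInterval × unitInterval | f q.1 = q.2} =
        {q | α * excess τ q.2 = (1 - α) * lowerGap τ q.1 q.2} := by
      ext ⟨c, x⟩
      simp only [mem_ofPred_eq]
      constructor
      · rintro rfl
        exact hf c
      · intro hx
        rcases lt_trichotomy (f c) x with h | h | h
        · linarith [hmono c h, hf c]
        · exact h
        · linarith [hmono c h, hf c]
    rw [this]
    exact isClosed_eq (by fun_prop) (continuous_const.mul
      (hu.comp (f := fun q : unitInterval × unitInterval => (q.1, (q.2 : ℝ))) (by fun_prop)))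
  · by_contra! h
    have := hmono c h
    rw [lowerGap_self] at this
    linarith [hf c]

omit [NullSingletonClass τ] in
/-- The cutoffs at which the two first-order conditions hold with `l = c` and with `h = c`. -/
theorem exists_cutoff_bounds (hα : α ∈ Icc (1 / 2 : ℝ) 1) (hα1 : α < 1) :
    ∃ a b : unitInterval, a ≤ b ∧ 0 < (a : ℝ) ∧ (b : ℝ) < 1 ∧
      (1 - α) * excess τ a = α * shortfall τ a ∧ (1 - α) * shortfall τ b = α * excess τ b := by
  have h0 : 0 < α := by linarith [hα.1]
  have h1 : 0 < 1 - α := sub_pos.2 hα1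
  have hs : Continuous (shortfall τ) := continuous_shortfall
  have he : Continuous (excess τ) := continuous_excess
  obtain ⟨a, -, ha⟩ := isPreconnected_univ.intermediate_value₂ (mem_univ (1 : unitInterval))
    (mem_univ (0 : unitInterval)) (f := fun x : unitInterval => (1 - α) * excess τ x)
    (g := fun x : unitInterval => α * shortfall τ x) (by fun_prop) (by fun_prop)
    (by
      simp only [Icc.coe_one, excess_one, mul_zero]
      exact mul_nonneg h0.le (shortfall_nonneg _))
    (by
      simp only [Icc.coe_zero, shortfall_zero, mul_zero]
      exact mul_nonneg h1.le (excess_nonneg _))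
  obtain ⟨b, -, hb⟩ := isPreconnected_univ.intermediate_value₂ (mem_univ (0 : unitInterval))
    (mem_univ (1 : unitInterval)) (f := fun x : unitInterval => (1 - α) * shortfall τ x)
    (g := fun x : unitInterval => α * excess τ x) (by fun_prop) (by fun_prop)
    (by
      simp only [Icc.coe_zero, shortfall_zero, mul_zero]
      exact mul_nonneg h0.le (excess_nonneg _))
    (by
      simp only [Icc.coe_one, excess_one, mul_zero]
      exact mul_nonneg h1.le (shortfall_nonneg _))
  refine ⟨a, b, ?_, ?_, ?_, ha, hb⟩
  -- Since `1 - α ≤ α`, shortfall is at most excess at `a` and at least excess at `b`, so the mean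
  -- separates the two.
  · have ea := shortfall_sub_excess (τ := τ) a
    have eb := shortfall_sub_excess (τ := τ) b
    have na : shortfall τ a ≤ excess τ a := by
      nlinarith [hα.1, excess_nonneg (τ := τ) a, shortfall_nonneg (τ := τ) a]
    have nb : excess τ b ≤ shortfall τ b := by
      nlinarith [hα.1, excess_nonneg (τ := τ) b, shortfall_nonneg (τ := τ) b]
    refine Subtype.coe_le_coe.1 ?_
    linarith
  · by_contra! h
    have h' : (a : ℝ) = 0 := le_antisymm h a.2.1
    rw [h', shortfall_zero, mul_zero] at ha
    linarith [mul_pos h1 (excess_pos (τ := τ) (x := 0) le_rfl (by norm_num))]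
  · by_contra! h
    have h' : (b : ℝ) = 1 := le_antisymm b.2.2 h
    rw [h', excess_one, mul_zero] at hb
    linarith [mul_pos h1 (shortfall_pos (τ := τ) (x := 1) (by norm_num) le_rfl)]

/-- For `c` in `[a, b]` the roots satisfy `fl c ≤ c ≤ fh c` and are interior, where slopes are
derivatives and so vary continuously. At `c = a` the line at `l` touches `V`, at `c = b` the line at
`h` does; in between the two lines must agree at `c`. -/
theorem exists_isSaddle {g : unitInterval → ℝ} (hg : ∀ p : unitInterval, IsSubgradient V p (g p))
    (hK : ∀ p, |g p| ≤ K) (hVc : Continuous fun s : unitInterval => V s)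
    (hd : DifferentiableOn ℝ V (Ioo (0 : ℝ) 1)) (hd' : ContinuousOn (deriv V) (Ioo (0 : ℝ) 1))
    (hα : α ∈ Icc (1 / 2 : ℝ) 1) : ∃ l h c k₁ k₂, IsSaddle τ V K α l h c k₁ k₂ := by
  rcases hα.2.eq_or_lt with rfl | hα1
  -- With full alignment the bounds are the endpoints, and the cutoff is only needed as a crossing
  -- of their lines.
  · obtain ⟨c, -, hc⟩ := isPreconnected_univ.intermediate_value₂ (mem_univ (1 : unitInterval))
      (mem_univ (0 : unitInterval))
      (f := fun x : unitInterval => V 0 + g 0 * ((x : ℝ) - 0))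
      (g := fun x : unitInterval => V 1 + g 1 * ((x : ℝ) - 1)) (by fun_prop) (by fun_prop)
      (by simpa using hg 0 1 (by simp)) (by simpa using hg 1 0 (by simp))
    refine ⟨0, 1, c, g 0, g 1, ?_⟩
    exact ⟨c.2.1, c.2.2, by simp [shortfall_zero], by simp [excess_one], hK _, hK _, hg _, hg _,
      by simpa using hc⟩
  obtain ⟨a, b, hab, ha0, hb1, ha, hb⟩ := exists_cutoff_bounds (τ := τ) hα hα1
  obtain ⟨fl, hflc, hfl, hfle⟩ := exists_low (τ := τ) hα
  obtain ⟨fh, hfhc, hfh, hfhe⟩ := exists_high (τ := τ) hα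
  have h0 : 0 ≤ α := by linarith [hα.1]
  have h1 : 0 ≤ 1 - α := sub_nonneg.2 hα.2
  have hle : ∀ c ∈ Icc a b, fl c ≤ c := fun c hc => hfle c <|
    (mul_le_mul_of_nonneg_left (excess_anti (Subtype.coe_le_coe.2 hc.1)) h1).trans
      (ha.le.trans (mul_le_mul_of_nonneg_left (shortfall_mono (Subtype.coe_le_coe.2 hc.1)) h0))
  have hge : ∀ c ∈ Icc a b, c ≤ fh c := fun c hc => hfhe c <|
    (mul_le_mul_of_nonneg_left (shortfall_mono (Subtype.coe_le_coe.2 hc.2)) h1).trans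
      (hb.le.trans (mul_le_mul_of_nonneg_left (excess_anti (Subtype.coe_le_coe.2 hc.2)) h0))
  have hc0 : ∀ c ∈ Icc a b, 0 < (c : ℝ) := fun c hc => ha0.trans_le (Subtype.coe_le_coe.2 hc.1)
  have hc1 : ∀ c ∈ Icc a b, (c : ℝ) < 1 := fun c hc => (Subtype.coe_le_coe.2 hc.2).trans_lt hb1
  have hflm : ∀ c ∈ Icc a b, (fl c : ℝ) ∈ Ioo (0 : ℝ) 1 := fun c hc =>
    ⟨low_pos hα1 (hfl c) (hc1 c hc), (Subtype.coe_le_coe.2 (hle c hc)).trans_lt (hc1 c hc)⟩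
  have hfhm : ∀ c ∈ Icc a b, (fh c : ℝ) ∈ Ioo (0 : ℝ) 1 := fun c hc =>
    ⟨(hc0 c hc).trans_le (Subtype.coe_le_coe.2 (hge c hc)), high_lt hα1 (hfh c) (hc0 c hc)⟩
  have hgc : ∀ f : unitInterval → unitInterval, Continuous f →
      (∀ c ∈ Icc a b, (f c : ℝ) ∈ Ioo (0 : ℝ) 1) → ContinuousOn (fun c => g (f c)) (Icc a b) := by
    intro f hf hm
    refine (hd'.comp (f := fun c => (f c : ℝ)) (by fun_prop) hm).congr fun c hc => ?_
    exact (hg (f c)).eq_deriv (hm c hc)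
      (hd.differentiableAt (Ioo_mem_nhds (hm c hc).1 (hm c hc).2))
  have hline : ∀ f : unitInterval → unitInterval, Continuous f →
      (∀ c ∈ Icc a b, (f c : ℝ) ∈ Ioo (0 : ℝ) 1) →
      ContinuousOn (fun c : unitInterval => V (f c) + g (f c) * ((c : ℝ) - f c)) (Icc a b) := by
    intro f hf hm
    exact (hVc.comp hf).continuousOn.add ((hgc f hf hm).mul (by fun_prop))
  have haa : a ∈ Icc a b := left_mem_Icc.2 hab
  have hbb : b ∈ Icc a b := right_mem_Icc.2 hab
  have hla : fl a = a := by
    refine le_antisymm (hle a haa) (not_lt.1 fun h => ?_)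
    have e1 := mul_le_mul_of_nonneg_left (upperGap_anti (τ := τ) a (Subtype.coe_le_coe.2 h.le)) h1
    have e2 := mul_lt_mul_of_pos_left (shortfall_lt (τ := τ) (fl a).2.1 a.2.2 h)
      (by linarith [hα.1] : 0 < α)
    rw [upperGap_self] at e1
    linarith [hfl a]
  have hhb : fh b = b := by
    refine le_antisymm (not_lt.1 fun h => ?_) (hge b hbb)
    have e1 := mul_le_mul_of_nonneg_left (lowerGap_mono (τ := τ) b (Subtype.coe_le_coe.2 h.le)) h1
    have e2 := mul_lt_mul_of_pos_left (excess_lt (τ := τ) b.2.1 (fh b).2.2 h)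
      (by linarith [hα.1] : 0 < α)
    rw [lowerGap_self] at e1
    linarith [hfh b]
  obtain ⟨c, hc, hcross⟩ := isPreconnected_Icc.intermediate_value₂ hbb haa
    (hline fl hflc hflm) (hline fh hfhc hfhm)
    (by
      simp only [hhb, sub_self, mul_zero, add_zero]
      exact hg (fl b) b b.2)
    (by
      simp only [hla, sub_self, mul_zero, add_zero]
      exact hg (fh a) a a.2)
  exact ⟨fl c, fh c, c, g (fl c), g (fh c), hle c hc, hge c hc, hfl c, hfh c, hK _, hK _,
    hg _, hg _, hcross⟩

end Existence

/-! ### Measurable selection of maximizers -/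

section Selection

/-- The binary sequence that agrees with `v` before position `n` and with `b` from there on. -/
def splice (n : ℕ) (v b : ℕ → Bool) : ℕ → Bool := fun i => if i < n then v i else b i

theorem continuous_splice (n : ℕ) :
    Continuous fun q : (ℕ → Bool) × (ℕ → Bool) => splice n q.1 q.2 := by
  refine continuous_pi fun i => ?_
  by_cases h : i < n
  · simp only [splice, h, if_true]; fun_prop
  · simp only [splice, h, if_false]; fun_prop

/-- The supremum of `G` over the sequences that agree with `v` before position `n`. -/
noncomputable def cylinderSup (G : (ℕ → Bool) → ℝ) (n : ℕ) (v : ℕ → Bool) : ℝ :=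
  ⨆ k, G (splice n v (TopologicalSpace.denseSeq (ℕ → Bool) k))

theorem bddAbove_range_of_continuous {Y ι : Type*} [TopologicalSpace Y] [CompactSpace Y]
    {G : Y → ℝ} (hG : Continuous G) (f : ι → Y) : BddAbove (range fun k => G (f k)) :=
  (isCompact_range hG).bddAbove.mono (range_subset_iff.2 fun k => mem_range_self (f k))

theorem le_cylinderSup {G : (ℕ → Bool) → ℝ} (hG : Continuous G) (n : ℕ) (v b : ℕ → Bool) :
    G (splice n v b) ≤ cylinderSup G n v := by
  have hc : Continuous fun b => G (splice n v b) :=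
    hG.comp ((continuous_splice n).comp (continuous_const.prodMk continuous_id))
  by_contra! h
  obtain ⟨k, hk⟩ := (TopologicalSpace.denseRange_denseSeq (ℕ → Bool)).exists_mem_open
    (isOpen_lt continuous_const hc) ⟨b, h⟩
  exact (le_ciSup (bddAbove_range_of_continuous hG _) k).not_gt hk

theorem exists_eq_cylinderSup {G : (ℕ → Bool) → ℝ} (hG : Continuous G) (n : ℕ) (v : ℕ → Bool) :
    ∃ b, G (splice n v b) = cylinderSup G n v := by
  have hc : Continuous fun b => G (splice n v b) :=
    hG.comp ((continuous_splice n).comp (continuous_const.prodMk continuous_id))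
  obtain ⟨b, -, hb⟩ := isCompact_univ.exists_isMaxOn univ_nonempty hc.continuousOn
  exact ⟨b, le_antisymm (le_cylinderSup hG n v b) (ciSup_le fun k => hb (mem_univ _))⟩

variable {X : Type*}

open Classical in
/-- The greedy choice of the first `n` bits of a maximizer of `G x`. -/
noncomputable def greedyBits (G : X → (ℕ → Bool) → ℝ) : ℕ → X → (ℕ → Bool)
  | 0, _ => fun _ => false
  | n + 1, x => Function.update (greedyBits G n x) n
      -- At position `0` the prefix is irrelevant, so the right-hand side is the global maximum: bit
      -- `true` is taken only when `false` cannot reach it.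
      (if cylinderSup (G x) (n + 1) (Function.update (greedyBits G n x) n false) <
        cylinderSup (G x) 0 (greedyBits G n x) then true else false)

/-- The invariant is that the chosen prefix extends to a global maximizer. If bit `false` falls
short of the maximum, any such extension has bit `true`. -/
theorem greedyBits_maximal {G : X → (ℕ → Bool) → ℝ} (hG : ∀ x, Continuous (G x)) (n : ℕ) (x : X) :
    ∃ b, ∀ b', G x b' ≤ G x (splice n (greedyBits G n x) b) := by
  have h0 : ∀ v b, splice 0 v b = b := fun v b => by ext i; simp [splice]
  induction n with
  | zero =>
    obtain ⟨b, hb⟩ := exists_eq_cylinderSup (hG x) 0 (greedyBits G 0 x)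
    refine ⟨b, fun b' => ?_⟩
    rw [hb, ← h0 (greedyBits G 0 x) b']
    exact le_cylinderSup (hG x) _ _ _
  | succ n ih =>
    obtain ⟨b, hb⟩ := ih
    rw [greedyBits]
    split_ifs with h
    · refine ⟨b, fun b' => (hb b').trans (le_of_eq ?_)⟩
      congr 1
      have hbn : b n = true := by
        by_contra hbn
        have e : splice n (greedyBits G n x) b =
            splice (n + 1) (Function.update (greedyBits G n x) n false) b := by
          ext i
          rcases lt_trichotomy i n with hi | hi | hi
          · simp [splice, hi, hi.ne, Nat.lt_succ_of_lt hi]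
          · simpa [splice, hi] using hbn
          · simp [splice, hi.not_gt, Nat.not_lt.2 hi]
        have h1 := le_cylinderSup (hG x) (n + 1) (Function.update (greedyBits G n x) n false) b
        obtain ⟨b', hb'⟩ := exists_eq_cylinderSup (hG x) 0 (greedyBits G n x)
        have h2 := hb (splice 0 (greedyBits G n x) b')
        rw [e] at h2
        linarith
      ext i
      rcases lt_trichotomy i n with hi | hi | hi
      · simp [splice, hi, hi.ne, Nat.lt_succ_of_lt hi]
      · simp [splice, hi, hbn]
      · simp [splice, hi.not_gt, Nat.not_lt.2 hi]
    · obtain ⟨b', hb'⟩ := exists_eq_cylinderSup (hG x) (n + 1)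
        (Function.update (greedyBits G n x) n false)
      refine ⟨b', fun b'' => ?_⟩
      rw [hb', ← h0 (greedyBits G n x) b'']
      exact (le_cylinderSup (hG x) _ _ _).trans (not_lt.1 h)

theorem greedyBits_stable (G : X → (ℕ → Bool) → ℝ) (x : X) (i k : ℕ) :
    greedyBits G (i + 1 + k) x i = greedyBits G (i + 1) x i := by
  induction k with
  | zero => rfl
  | succ k ih =>
    rw [← ih, ← add_assoc, greedyBits, Function.update_of_ne (by omega)]

variable [MeasurableSpace X]

/-- The supremum is over a countable dense sequence, and Carathéodory functions are jointly
measurable. -/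
theorem measurable_cylinderSup {G : X → (ℕ → Bool) → ℝ} (hm : ∀ b, Measurable fun x => G x b)
    (hG : ∀ x, Continuous (G x)) (n : ℕ) :
    Measurable fun q : X × (ℕ → Bool) => cylinderSup (G q.1) n q.2 := by
  have hj : Measurable fun q : (ℕ → Bool) × X => G q.2 q.1 :=
    measurable_uncurry_of_continuous_of_measurable (u := fun b x => G x b) hG hm
  refine Measurable.iSup fun k => ?_
  refine hj.comp (Measurable.prodMk ?_ measurable_fst)
  exact (continuous_splice n).measurable.comp (measurable_snd.prodMk measurable_const)

theorem measurable_greedyBits {G : X → (ℕ → Bool) → ℝ} (hm : ∀ b, Measurable fun x => G x b)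
    (hG : ∀ x, Continuous (G x)) (n : ℕ) : Measurable (greedyBits G n) := by
  induction n with
  | zero => exact measurable_const
  | succ n ih =>
    have hup : Measurable fun q : (ℕ → Bool) × Bool => Function.update q.1 n q.2 := by
      refine measurable_pi_iff.2 fun i => ?_
      by_cases h : i = n
      · subst h; simpa using measurable_snd
      · simp only [Function.update_of_ne h]
        exact (measurable_pi_apply i).comp measurable_fst
    refine hup.comp (ih.prodMk (Measurable.ite (measurableSet_lt ?_ ?_) measurable_const
      measurable_const))
    · exact (measurable_cylinderSup hm hG (n + 1)).comp
        (measurable_id.prodMk (hup.comp (ih.prodMk measurable_const)))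
    · exact (measurable_cylinderSup hm hG 0).comp (measurable_id.prodMk ih)

/-- A measurable choice of maximizers of a Carathéodory function on a compact metric space. -/
theorem exists_measurable_argmax {A : Type*} [MetricSpace A] [CompactSpace A] [Nonempty A]
    [MeasurableSpace A] [BorelSpace A] {F : X → A → ℝ} (hm : ∀ a, Measurable fun x => F x a)
    (hF : ∀ x, Continuous (F x)) : ∃ f : X → A, Measurable f ∧ ∀ x a, F x a ≤ F x (f x) := by
  -- A compact metric space is a continuous image of Cantor space, where maximizers can be picked
  -- bit by bit.
  obtain ⟨φ, hφ, hsurj⟩ := exists_nat_bool_continuous_surjective_of_compact A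
  let G : X → (ℕ → Bool) → ℝ := fun x b => F x (φ b)
  have hG : ∀ x, Continuous (G x) := fun x => (hF x).comp hφ
  have hmG : ∀ b, Measurable fun x => G x b := fun b => hm (φ b)
  have hsel : ∀ i, Measurable fun x => greedyBits G (i + 1) x i := fun i =>
    measurable_pi_iff.1 (measurable_greedyBits hmG hG (i + 1)) i
  refine ⟨fun x => φ fun i => greedyBits G (i + 1) x i,
    hφ.measurable.comp (measurable_pi_iff.2 hsel), fun x a => ?_⟩
  choose b hb using fun n => greedyBits_maximal hG n x
  -- The maximizers extending ever longer prefixes converge to the greedy sequence, which is a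
  -- maximizer by continuity.
  have hlim : Filter.Tendsto (fun n => splice n (greedyBits G n x) (b n)) Filter.atTop
      (nhds fun i => greedyBits G (i + 1) x i) := by
    refine tendsto_pi_nhds.2 fun i => tendsto_const_nhds.congr' ?_
    filter_upwards [Filter.eventually_gt_atTop i] with n hn
    obtain ⟨k, rfl⟩ := Nat.exists_eq_add_of_le (Nat.succ_le_of_lt hn)
    rw [splice, if_pos hn]
    exact (greedyBits_stable G x i k).symm
  obtain ⟨b', rfl⟩ := hsurj a
  exact ge_of_tendsto' (((hG x).tendsto _).comp hlim) fun n => hb n b'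

end Selection

/-! ### Payoffs and Bayes-optimal strategies -/

namespace Model

section Measurability

variable {A Θ : Type*} [TopologicalSpace A] [MeasurableSpace A] [MeasurableSpace Θ]
  (E : Model A Θ)

/-- The expected payoff of a private strategy in state `ω` given the type. -/
noncomputable def typePayoff (ρ : Strategy Θ A) (ω : Fin 2) (θ : Θ) : ℝ := ∫ a, E.u a ω θ ∂(ρ.1 θ)

theorem integrable_u (ρ : Strategy Θ A) (ω : Fin 2) (θ : Θ) :
    Integrable (fun a => E.u a ω θ) (ρ.1 θ) := by
  obtain ⟨C, hC⟩ := E.bounded_u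
  have := ρ.2
  exact Integrable.of_bound ((E.measurable_u ω).comp measurable_prodMk_right).aestronglyMeasurable C
    (Filter.Eventually.of_forall fun a => hC a ω θ)

theorem abs_integral_le {X : Type*} [MeasurableSpace X] {μ : Measure X} [IsProbabilityMeasure μ]
    {f : X → ℝ} {C : ℝ} (h : ∀ x, |f x| ≤ C) : |∫ x, f x ∂μ| ≤ C := by
  simpa using norm_integral_le_of_norm_le_const (μ := μ) (f := f) (C := C)
    (Filter.Eventually.of_forall h)

theorem abs_typePayoff_le {C : ℝ} (hC : ∀ a ω θ, |E.u a ω θ| ≤ C) (ρ : Strategy Θ A) (ω : Fin 2)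
    (θ : Θ) : |E.typePayoff ρ ω θ| ≤ C :=
  have := ρ.2
  abs_integral_le fun a => hC a ω θ

theorem abs_statePayoff_le {C : ℝ} (hC : ∀ a ω θ, |E.u a ω θ| ≤ C) (ρ : Strategy Θ A)
    (ω : Fin 2) : |E.statePayoff ρ ω| ≤ C :=
  abs_integral_le fun θ => E.abs_typePayoff_le hC ρ ω θ

theorem abs_privatePayoff_le {C : ℝ} (hC : ∀ a ω θ, |E.u a ω θ| ≤ C) (ρ : Strategy Θ A)
    (p : unitInterval) : |E.privatePayoff ρ p| ≤ C := by
  have h0 := abs_le.1 (E.abs_statePayoff_le hC ρ 0)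
  have h1 := abs_le.1 (E.abs_statePayoff_le hC ρ 1)
  rw [privatePayoff, abs_le]
  constructor <;> nlinarith [p.2.1, p.2.2]

theorem measurable_typePayoff (ρ : Strategy Θ A) (ω : Fin 2) : Measurable (E.typePayoff ρ ω) := by
  have := ρ.2
  refine (StronglyMeasurable.integral_kernel_prod_right (κ := ρ.1) (f := fun θ a => E.u a ω θ)
    ?_).measurable
  exact ((E.measurable_u ω).comp measurable_swap).stronglyMeasurable

theorem measurable_statePayoff (σ : Strategy (unitInterval × Θ) A) (ω : Fin 2) :
    Measurable fun m => E.statePayoff (privateOf σ m) ω := by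
  have := σ.2
  have h1 : StronglyMeasurable fun q : unitInterval × Θ => ∫ a, E.u a ω q.2 ∂(σ.1 q) := by
    refine StronglyMeasurable.integral_kernel_prod_right (κ := σ.1)
      (f := fun q a => E.u a ω q.2) ?_
    exact ((E.measurable_u ω).comp
      (measurable_snd.prodMk (measurable_snd.comp measurable_fst))).stronglyMeasurable
  exact h1.integral_prod_right'.measurable

theorem measurable_privatePayoff (σ : Strategy (unitInterval × Θ) A) :
    Measurable fun q : unitInterval × unitInterval => E.privatePayoff (privateOf σ q.1) q.2 := by
  have h0 : Measurable fun q : unitInterval × unitInterval => E.statePayoff (privateOf σ q.1) 0 :=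
    (E.measurable_statePayoff σ 0).comp measurable_fst
  have h1 : Measurable fun q : unitInterval × unitInterval => E.statePayoff (privateOf σ q.1) 1 :=
    (E.measurable_statePayoff σ 1).comp measurable_fst
  have hs : Measurable fun q : unitInterval × unitInterval => (q.2 : ℝ) :=
    measurable_subtype_coe.comp measurable_snd
  exact ((measurable_const.sub hs).mul h0).add (hs.mul h1)

/-- The density of the type distribution in state `ω` with respect to the sum of the two. -/
noncomputable def typeDensity (ω : Fin 2) (θ : Θ) : ℝ :=
  ((E.f ω : Measure Θ).rnDeriv ((E.f 0 : Measure Θ) + (E.f 1 : Measure Θ)) θ).toReal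

theorem measurable_typeDensity (ω : Fin 2) : Measurable (E.typeDensity ω) :=
  (Measure.measurable_rnDeriv _ _).ennreal_toReal

/-- Both type laws are absolutely continuous with respect to their sum. Writing the payoff as one
integral over types allows maximization type by type. -/
theorem integral_typeDensity_mul (ω : Fin 2) (f : Θ → ℝ) :
    ∫ θ, E.typeDensity ω θ * f θ ∂((E.f 0 : Measure Θ) + (E.f 1 : Measure Θ)) =
      ∫ θ, f θ ∂(E.f ω : Measure Θ) := by
  refine integral_rnDeriv_smul (f := f) ?_
  fin_cases ω
  · exact Measure.absolutelyContinuous_of_le (Measure.le_add_right le_rfl)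
  · exact Measure.absolutelyContinuous_of_le (Measure.le_add_left le_rfl)

theorem integrable_typeDensity_mul (ω : Fin 2) {f : Θ → ℝ} (hf : Measurable f) {C : ℝ}
    (hC : ∀ θ, |f θ| ≤ C) :
    Integrable (fun θ => E.typeDensity ω θ * f θ) ((E.f 0 : Measure Θ) + (E.f 1 : Measure Θ)) :=
  Measure.integrable_toReal_rnDeriv.mul_bdd hf.aestronglyMeasurable
    (Filter.Eventually.of_forall hC)

/-- The type-density weighted payoff of an action at a belief and type. -/
noncomputable def weightedPayoff (q : unitInterval × Θ) (a : A) : ℝ :=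
  (1 - (q.1 : ℝ)) * (E.typeDensity 0 q.2 * E.u a 0 q.2) +
    (q.1 : ℝ) * (E.typeDensity 1 q.2 * E.u a 1 q.2)

theorem privatePayoff_eq_integral (ρ : Strategy Θ A) (p : ℝ) :
    E.privatePayoff ρ p = ∫ θ, ((1 - p) * (E.typeDensity 0 θ * E.typePayoff ρ 0 θ) +
      p * (E.typeDensity 1 θ * E.typePayoff ρ 1 θ)) ∂((E.f 0 : Measure Θ) + (E.f 1 : Measure Θ)) ∧
    Integrable (fun θ => (1 - p) * (E.typeDensity 0 θ * E.typePayoff ρ 0 θ) +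
      p * (E.typeDensity 1 θ * E.typePayoff ρ 1 θ)) ((E.f 0 : Measure Θ) + (E.f 1 : Measure Θ)) := by
  obtain ⟨C, hC⟩ := E.bounded_u
  have hi := fun ω => E.integrable_typeDensity_mul ω (E.measurable_typePayoff ρ ω)
    (E.abs_typePayoff_le hC ρ ω)
  refine ⟨?_, ((hi 0).const_mul _).add ((hi 1).const_mul _)⟩
  rw [integral_add ((hi 0).const_mul _) ((hi 1).const_mul _), integral_const_mul,
    integral_const_mul, integral_typeDensity_mul, integral_typeDensity_mul]
  rfl

theorem integral_weightedPayoff (ρ : Strategy Θ A) (p : unitInterval) (θ : Θ) :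
    (1 - (p : ℝ)) * (E.typeDensity 0 θ * E.typePayoff ρ 0 θ) +
      p * (E.typeDensity 1 θ * E.typePayoff ρ 1 θ) = ∫ a, E.weightedPayoff (p, θ) a ∂(ρ.1 θ) := by
  simp only [weightedPayoff]
  rw [integral_add (((E.integrable_u ρ 0 θ).const_mul _).const_mul _)
    (((E.integrable_u ρ 1 θ).const_mul _).const_mul _)]
  simp only [integral_const_mul, typePayoff]

end Measurability

section BayesOptimal

variable {A Θ : Type*} [MetricSpace A] [CompactSpace A] [Nonempty A] [MeasurableSpace A]
  [BorelSpace A] [MeasurableSpace Θ] (E : Model A Θ)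

/-- A strategy that responds Bayes-optimally to every belief. -/
theorem exists_bayesOptimal :
    ∃ σ : Strategy (unitInterval × Θ) A, ∀ p, E.IsBayesOptimal (privateOf σ p) p := by
  have hm : ∀ a, Measurable fun q : unitInterval × Θ => E.weightedPayoff q a := by
    intro a
    have hd : ∀ ω, Measurable fun q : unitInterval × Θ => E.typeDensity ω q.2 * E.u a ω q.2 :=
      fun ω => ((E.measurable_typeDensity ω).mul
        ((E.measurable_u ω).comp measurable_prodMk_left)).comp measurable_snd
    have hp : Measurable fun q : unitInterval × Θ => (q.1 : ℝ) :=
      measurable_subtype_coe.comp measurable_fst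
    exact ((measurable_const.sub hp).mul (hd 0)).add (hp.mul (hd 1))
  have hc : ∀ q, Continuous (E.weightedPayoff q) := fun q =>
    (continuous_const.mul (continuous_const.mul (E.continuous_u 0 q.2))).add
      (continuous_const.mul (continuous_const.mul (E.continuous_u 1 q.2)))
  -- The selection is measurable jointly in belief and type, so it is a strategy whose messages are
  -- beliefs.
  obtain ⟨f, hf, hmax⟩ := exists_measurable_argmax hm hc
  refine ⟨⟨Kernel.deterministic f hf, inferInstance⟩, fun p ρ => ?_⟩
  rw [(E.privatePayoff_eq_integral _ _).1, (E.privatePayoff_eq_integral _ _).1]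
  refine integral_mono (E.privatePayoff_eq_integral _ _).2 (E.privatePayoff_eq_integral _ _).2
    fun θ => ?_
  simp only [integral_weightedPayoff]
  have hdirac : ∫ a, E.weightedPayoff (p, θ) a
      ∂((privateOf ⟨Kernel.deterministic f hf, inferInstance⟩ p).1 θ) =
      E.weightedPayoff (p, θ) (f (p, θ)) := by
    simp [privateOf, Kernel.deterministic_apply]
  rw [hdirac]
  have := ρ.2
  calc ∫ a, E.weightedPayoff (p, θ) a ∂(ρ.1 θ)
      ≤ ∫ _, E.weightedPayoff (p, θ) (f (p, θ)) ∂(ρ.1 θ) :=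
        integral_mono ((((E.integrable_u ρ 0 θ).const_mul _).const_mul _).add
          (((E.integrable_u ρ 1 θ).const_mul _).const_mul _)) (integrable_const _)
          fun a => hmax (p, θ) a
    _ = _ := by simp

end BayesOptimal

/-! ### The indirect payoff and its supporting lines. -/

section Indirect

variable {A Θ : Type*} [TopologicalSpace A] [MeasurableSpace A] [MeasurableSpace Θ]
  {E : Model A Θ}

/-- The slope of the payoff of a private strategy in the belief. -/
noncomputable def slope (E : Model A Θ) (ρ : Strategy Θ A) : ℝ :=
  E.statePayoff ρ 1 - E.statePayoff ρ 0

theorem privatePayoff_eq_line (ρ : Strategy Θ A) (p q : ℝ) :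
    E.privatePayoff ρ q = E.privatePayoff ρ p + E.slope ρ * (q - p) := by
  simp only [privatePayoff, slope]; ring

theorem privatePayoff_le_indirect (ρ : Strategy Θ A) (p : unitInterval) :
    E.privatePayoff ρ p ≤ E.indirect p := by
  obtain ⟨C, hC⟩ := E.bounded_u
  exact le_ciSup (f := fun ρ => E.privatePayoff ρ p)
    ⟨C, by rintro _ ⟨ρ', rfl⟩; exact (abs_le.1 (E.abs_privatePayoff_le hC ρ' p)).2⟩ ρ

theorem isBayesOptimal_iff {ρ : Strategy Θ A} {p : unitInterval} :
    E.IsBayesOptimal ρ p ↔ E.privatePayoff ρ p = E.indirect p := by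
  have : Nonempty (Strategy Θ A) := ⟨ρ⟩
  exact ⟨fun h => le_antisymm (privatePayoff_le_indirect ρ p) (ciSup_le h),
    fun h ρ' => h ▸ privatePayoff_le_indirect ρ' p⟩

theorem IsBayesOptimal.line {ρ : Strategy Θ A} {p : unitInterval} (h : E.IsBayesOptimal ρ p)
    (q : ℝ) : E.privatePayoff ρ q = E.indirect p + E.slope ρ * (q - p) := by
  rw [privatePayoff_eq_line ρ p q, isBayesOptimal_iff.1 h]

theorem IsBayesOptimal.isSubgradient {ρ : Strategy Θ A} {p : unitInterval}
    (h : E.IsBayesOptimal ρ p) : IsSubgradient E.indirect p (E.slope ρ) := fun s hs => by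
  rw [← h.line]
  exact privatePayoff_le_indirect ρ ⟨s, hs⟩

/-- A line supporting a strictly convex function touches it only once. -/
theorem IsBayesOptimal.unique (hV : StrictConvexOn ℝ (Icc (0 : ℝ) 1) E.indirect)
    {ρ : Strategy Θ A} {p q : unitInterval} (hp : E.IsBayesOptimal ρ p)
    (hq : E.IsBayesOptimal ρ q) : p = q := by
  by_contra hne
  have h := hp.isSubgradient.lt hV p.2 q.2 (Subtype.coe_ne_coe.2 hne)
  rw [← hp.line, isBayesOptimal_iff.1 hq] at h
  exact lt_irrefl _ h

theorem abs_slope_le {C : ℝ} (hC : ∀ a ω θ, |E.u a ω θ| ≤ C) (ρ : Strategy Θ A) :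
    |E.slope ρ| ≤ 2 * C := by
  have h0 := abs_le.1 (E.abs_statePayoff_le hC ρ 0)
  have h1 := abs_le.1 (E.abs_statePayoff_le hC ρ 1)
  rw [slope, abs_le]
  constructor <;> linarith

/-- Bounded supporting slopes give a Lipschitz bound. This covers the endpoints, where convexity
alone does not yield continuity. -/
theorem continuous_of_bounded_subgradients {V : ℝ → ℝ} {K : ℝ}
    {g : unitInterval → ℝ} (hg : ∀ p : unitInterval, IsSubgradient V p (g p))
    (hK : ∀ p, |g p| ≤ K) : Continuous fun s : unitInterval => V s := by
  have key : ∀ p q : unitInterval, V p - V q ≤ K * |(p : ℝ) - q| := by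
    intro p q
    have h1 := hg p q q.2
    have h2 : g p * ((p : ℝ) - q) ≤ K * |(p : ℝ) - q| := by
      refine (le_abs_self _).trans ?_
      rw [abs_mul]
      exact mul_le_mul_of_nonneg_right (hK p) (abs_nonneg _)
    linarith
  refine (LipschitzWith.of_dist_le' (K := K) fun p q => ?_).continuous
  rw [Real.dist_eq, Subtype.dist_eq, Real.dist_eq, abs_le]
  have h1 := key p q
  have h2 := key q p
  rw [abs_sub_comm] at h2
  constructor <;> linarith

end Indirect

/-! ### The posterior's distribution: no atoms and full support. -/

section PosteriorLaw

variable {A Θ : Type*} [TopologicalSpace A] [MeasurableSpace A] [MeasurableSpace Θ]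
  (E : Model A Θ)

theorem density_nonneg_ae : 0 ≤ᵐ[volume] E.density := E.density_pos.mono fun _ h => h.le

theorem integrable_density : Integrable E.density :=
  by_contra fun h => by simpa [integral_undef h] using E.integral_density

instance isProbabilityMeasure_posteriorLaw : IsProbabilityMeasure E.posteriorLaw := by
  refine ⟨?_⟩
  rw [posteriorLaw, withDensity_apply _ MeasurableSet.univ, Measure.restrict_univ,
    ← ofReal_integral_eq_lintegral_ofReal E.integrable_density E.density_nonneg_ae,
    E.integral_density, ENNReal.ofReal_one]

theorem volume_absolutelyContinuous_posteriorLaw : (volume : Measure unitInterval) ≪ E.posteriorLaw :=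
  withDensity_absolutelyContinuous' E.measurable_density.ennreal_ofReal.aemeasurable
    (E.density_pos.mono fun _ h => (ENNReal.ofReal_pos.2 h).ne')

instance nullSingletonClass_posteriorLaw : NullSingletonClass E.posteriorLaw :=
  ⟨fun x => withDensity_absolutelyContinuous _ _ (measure_singleton x)⟩

theorem integral_posteriorLaw (f : unitInterval → ℝ) :
    ∫ s, f s ∂E.posteriorLaw = ∫ s, f s * E.density s := by
  rw [posteriorLaw, integral_withDensity_eq_integral_toReal_smul
    E.measurable_density.ennreal_ofReal (Filter.Eventually.of_forall fun _ => ENNReal.ofReal_lt_top)]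
  refine integral_congr_ae (E.density_nonneg_ae.mono fun s hs => ?_)
  simp only [ENNReal.toReal_ofReal hs, smul_eq_mul, mul_comm]

theorem integral_coe_posteriorLaw : ∫ s : unitInterval, (s : ℝ) ∂E.posteriorLaw = E.prior := by
  rw [integral_posteriorLaw, E.bayes_plausible]

instance isOpenPosMeasure_volume_unitInterval : (volume : Measure unitInterval).IsOpenPosMeasure := by
  refine ⟨fun U hU ⟨x, hx⟩ => ?_⟩
  obtain ⟨O, hO, rfl⟩ := isOpen_induced_iff.1 hU
  -- A relatively open set around an endpoint still meets the open interval.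
  have hx' : (x : ℝ) ∈ closure (Ioo (0 : ℝ) 1) := by
    rw [closure_Ioo zero_ne_one]
    exact x.2
  have hpos := (hO.inter isOpen_Ioo).measure_pos volume (mem_closure_iff.1 hx' O hO hx)
  refine (hpos.trans_le ?_).ne'
  rw [unitInterval.volume_apply]
  exact measure_mono fun y hy => ⟨⟨y, Ioo_subset_Icc_self hy.2⟩, hy.1, rfl⟩

instance isOpenPosMeasure_posteriorLaw : E.posteriorLaw.IsOpenPosMeasure :=
  E.volume_absolutelyContinuous_posteriorLaw.isOpenPosMeasure

end PosteriorLaw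

end Model

/-! ### The saddle point of the game against a misaligned adviser -/

section Laws

variable {τ : Measure unitInterval}

/-- The distribution with density proportional to `φ` with respect to `τ`. -/
noncomputable def tiltedLaw (τ : Measure unitInterval) (φ : unitInterval → ℝ) :
    Measure unitInterval :=
  τ.withDensity fun s => ENNReal.ofReal (φ s / ∫ s, φ s ∂τ)

theorem integral_tiltedLaw {φ : unitInterval → ℝ} (hφ : Continuous φ) (h0 : ∀ s, 0 ≤ φ s)
    (f : unitInterval → ℝ) :
    ∫ s, f s ∂(tiltedLaw τ φ) = ∫ s, φ s / (∫ s, φ s ∂τ) * f s ∂τ := by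
  rw [tiltedLaw, integral_withDensity_eq_integral_toReal_smul
    (hφ.div_const _).measurable.ennreal_ofReal
    (Filter.Eventually.of_forall fun _ => ENNReal.ofReal_lt_top)]
  refine integral_congr_ae (Filter.Eventually.of_forall fun s => ?_)
  simp only [ENNReal.toReal_ofReal (div_nonneg (h0 s) (integral_nonneg h0)), smul_eq_mul]

theorem isProbabilityMeasure_tiltedLaw [IsFiniteMeasure τ] {φ : unitInterval → ℝ}
    (hφ : Continuous φ) (h0 : ∀ s, 0 ≤ φ s) (hpos : 0 < ∫ s, φ s ∂τ) :
    IsProbabilityMeasure (tiltedLaw τ φ) := by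
  refine ⟨?_⟩
  rw [tiltedLaw, withDensity_apply _ MeasurableSet.univ, Measure.restrict_univ,
    ← ofReal_integral_eq_lintegral_ofReal ((integrable_of_continuous hφ).div_const _)
      (Filter.Eventually.of_forall fun s => div_nonneg (h0 s) hpos.le),
    integral_div, div_self hpos.ne', ENNReal.ofReal_one]

open Classical in
/-- The adviser who draws his message from `κ₁` at posteriors above `c` and from `κ₂` below. -/
noncomputable def cutoffAdviser (c : unitInterval) (κ₁ κ₂ : Measure unitInterval)
    [IsProbabilityMeasure κ₁] [IsProbabilityMeasure κ₂] : Strategy unitInterval unitInterval :=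
  ⟨Kernel.piecewise (measurableSet_Ioi (a := c)) (Kernel.const _ κ₁) (Kernel.const _ κ₂),
    inferInstance⟩

theorem cutoffAdviser_apply_of_lt {c s : unitInterval} (κ₁ κ₂ : Measure unitInterval)
    [IsProbabilityMeasure κ₁] [IsProbabilityMeasure κ₂] (h : c < s) :
    (cutoffAdviser c κ₁ κ₂).1 s = κ₁ := by
  simp [cutoffAdviser, Kernel.piecewise_apply, h]

theorem cutoffAdviser_apply_of_le {c s : unitInterval} (κ₁ κ₂ : Measure unitInterval)
    [IsProbabilityMeasure κ₁] [IsProbabilityMeasure κ₂] (h : s ≤ c) :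
    (cutoffAdviser c κ₁ κ₂).1 s = κ₂ := by
  simp [cutoffAdviser, Kernel.piecewise_apply, h]

/-- The point of `[l, h]` closest to `m`. -/
def clamp (l h m : unitInterval) : unitInterval := max l (min h m)

theorem continuous_clamp (l h : unitInterval) : Continuous (clamp l h) := by
  unfold clamp; fun_prop

theorem clamp_mem {l h : unitInterval} (hlh : l ≤ h) (m : unitInterval) : clamp l h m ∈ Icc l h :=
  ⟨le_max_left _ _, max_le hlh (min_le_left _ _)⟩

theorem clamp_of_mem {l h m : unitInterval} (hm : m ∈ Icc l h) : clamp l h m = m := by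
  rw [clamp, min_eq_right hm.2, max_eq_right hm.1]

theorem clamp_of_le {l h m : unitInterval} (hm : m ≤ l) : clamp l h m = l := by
  rw [clamp, max_eq_left ((min_le_right _ _).trans hm)]

theorem clamp_of_ge {l h m : unitInterval} (hlh : l ≤ h) (hm : h ≤ m) : clamp l h m = h := by
  rw [clamp, min_eq_left hm, max_eq_right hlh]

theorem coe_clamp {l h : unitInterval} (hlh : l ≤ h) (m : unitInterval) :
    (clamp l h m : ℝ) = m + max ((l : ℝ) - m) 0 - max ((m : ℝ) - h) 0 := by
  have hlh' : (l : ℝ) ≤ h := hlh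
  rcases le_total m l with h1 | h1
  · have h1' : (m : ℝ) ≤ l := h1
    rw [clamp_of_le h1, max_eq_left (by linarith), max_eq_right (by linarith)]
    ring
  · have h1' : (l : ℝ) ≤ m := h1
    rcases le_total m h with h2 | h2
    · have h2' : (m : ℝ) ≤ h := h2
      rw [clamp_of_mem ⟨h1, h2⟩, max_eq_right (by linarith), max_eq_right (by linarith)]
      ring
    · have h2' : (h : ℝ) ≤ m := h2
      rw [clamp_of_ge hlh h2, max_eq_right (by linarith), max_eq_left (by linarith)]
      ring

/-- The density of messages, relative to truthful reports, when a misaligned adviser reports low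
at posteriors above `c` and high below. -/
noncomputable def messageDensity (τ : Measure unitInterval) (α : ℝ) (l h c m : unitInterval) : ℝ :=
  α + (1 - α) * (τ.real (Ioi c) * (max ((l : ℝ) - m) 0 / shortfall τ l) +
    τ.real (Iic c) * (max ((m : ℝ) - h) 0 / excess τ h))

theorem continuous_messageDensity (α : ℝ) (l h c : unitInterval) :
    Continuous (messageDensity τ α l h c) := by
  unfold messageDensity; fun_prop

theorem le_messageDensity {α : ℝ} (hα : α ≤ 1) (l h c m : unitInterval) :
    α ≤ messageDensity τ α l h c m := by
  have h1 : 0 ≤ 1 - α := sub_nonneg.2 hα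
  have h2 := shortfall_nonneg (τ := τ) l
  have h3 := excess_nonneg (τ := τ) h
  rw [messageDensity, le_add_iff_nonneg_right]
  positivity

end Laws

/-! ### Payoffs against the saddle point adviser. -/

namespace Model

variable {A Θ : Type*} [TopologicalSpace A] [MeasurableSpace A] [MeasurableSpace Θ]
  {E : Model A Θ}

theorem integrable_message (E : Model A Θ) (σ : Strategy (unitInterval × Θ) A) (κ : Measure unitInterval)
    [IsFiniteMeasure κ] {f : unitInterval → unitInterval} (hf : Measurable f) :
    Integrable (fun m => E.privatePayoff (privateOf σ m) (f m)) κ := by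
  obtain ⟨C, hC⟩ := E.bounded_u
  exact Integrable.of_bound ((E.measurable_privatePayoff σ).comp
    (measurable_id.prodMk hf)).aestronglyMeasurable C
    (Filter.Eventually.of_forall fun m => E.abs_privatePayoff_le hC _ _)

theorem integrable_slope (E : Model A Θ) (σ : Strategy (unitInterval × Θ) A) (κ : Measure unitInterval)
    [IsFiniteMeasure κ] : Integrable (fun m => E.slope (privateOf σ m)) κ := by
  obtain ⟨C, hC⟩ := E.bounded_u
  exact Integrable.of_bound ((E.measurable_statePayoff σ 1).sub
    (E.measurable_statePayoff σ 0)).aestronglyMeasurable (2 * C)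
    (Filter.Eventually.of_forall fun m => abs_slope_le hC _)

theorem integrable_payoff (E : Model A Θ) (β : Strategy unitInterval unitInterval)
    (σ : Strategy (unitInterval × Θ) A) :
    Integrable (fun s : unitInterval => ∫ m, E.privatePayoff (privateOf σ m) s ∂(β.1 s))
      E.posteriorLaw := by
  obtain ⟨C, hC⟩ := E.bounded_u
  have := β.2
  refine Integrable.of_bound (StronglyMeasurable.integral_kernel_prod_right (κ := β.1)
    (f := fun s m => E.privatePayoff (privateOf σ m) s)
    ((E.measurable_privatePayoff σ).comp measurable_swap).stronglyMeasurable).aestronglyMeasurable C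
    (Filter.Eventually.of_forall fun s => abs_integral_le fun m => E.abs_privatePayoff_le hC _ _)

theorem bddBelow_payoff (E : Model A Θ) (σ : Strategy (unitInterval × Θ) A) :
    BddBelow (range fun β => E.payoff β σ) := by
  obtain ⟨C, hC⟩ := E.bounded_u
  refine ⟨-C, ?_⟩
  rintro _ ⟨β, rfl⟩
  have := β.2
  exact (abs_le.1 (abs_integral_le fun s => abs_integral_le fun m =>
    E.abs_privatePayoff_le hC (privateOf σ m) s)).1

theorem payoff_truthful (σ : Strategy (unitInterval × Θ) A) :
    E.payoff truthful σ = ∫ s, E.privatePayoff (privateOf σ s) s ∂E.posteriorLaw := by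
  simp [payoff, truthful, Kernel.id_apply]

theorem integral_line (σ : Strategy (unitInterval × Θ) A) (κ : Measure unitInterval)
    [IsProbabilityMeasure κ] (p s : unitInterval) :
    ∫ m, E.privatePayoff (privateOf σ m) s ∂κ =
      ∫ m, E.privatePayoff (privateOf σ m) p ∂κ + (s - p) * ∫ m, E.slope (privateOf σ m) ∂κ := by
  rw [← integral_const_mul, ← integral_add (E.integrable_message σ κ (f := fun _ => p)
    measurable_const) ((E.integrable_slope σ κ).const_mul _)]
  simp_rw [privatePayoff_eq_line _ (p : ℝ) (s : ℝ), mul_comm]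

/-- Payoffs are affine in the posterior, so integrating over either side of `c` needs only its mass
and first moment. The latter is recorded relative to pivots `l` and `h`. -/
theorem payoff_cutoffAdviser (σ : Strategy (unitInterval × Θ) A) (l h c : unitInterval)
    (κ₁ κ₂ : Measure unitInterval) [IsProbabilityMeasure κ₁] [IsProbabilityMeasure κ₂] :
    E.payoff (cutoffAdviser c κ₁ κ₂) σ =
      E.posteriorLaw.real (Ioi c) * ∫ m, E.privatePayoff (privateOf σ m) l ∂κ₁ +
        upperGap E.posteriorLaw c l * ∫ m, E.slope (privateOf σ m) ∂κ₁ +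
      (E.posteriorLaw.real (Iic c) * ∫ m, E.privatePayoff (privateOf σ m) h ∂κ₂ -
        lowerGap E.posteriorLaw c h * ∫ m, E.slope (privateOf σ m) ∂κ₂) := by
  set X₁ := ∫ m, E.privatePayoff (privateOf σ m) l ∂κ₁ with hX₁
  set Y₁ := ∫ m, E.slope (privateOf σ m) ∂κ₁ with hY₁
  set X₂ := ∫ m, E.privatePayoff (privateOf σ m) h ∂κ₂ with hX₂
  set Y₂ := ∫ m, E.slope (privateOf σ m) ∂κ₂ with hY₂
  have key : ∀ s : unitInterval, ∫ m, E.privatePayoff (privateOf σ m) s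
      ∂((cutoffAdviser c κ₁ κ₂).1 s) =
      ((Ioi c).indicator (fun _ => X₁) s +
        (Ioi c).indicator (fun s : unitInterval => (s : ℝ) - l) s * Y₁) +
      ((Iic c).indicator (fun _ => X₂) s -
        (Iic c).indicator (fun s : unitInterval => (h : ℝ) - s) s * Y₂) := by
    intro s
    rcases lt_or_ge c s with hs | hs
    · rw [cutoffAdviser_apply_of_lt κ₁ κ₂ hs, integral_line σ κ₁ l s]
      simp [indicator_of_mem, hs, hX₁, hY₁]
    · rw [cutoffAdviser_apply_of_le κ₁ κ₂ hs, integral_line σ κ₂ h s]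
      simp only [mem_Ioi, hs.not_gt, not_false_eq_true, indicator_of_notMem, mem_Iic, hs,
        indicator_of_mem, hX₂, hY₂]
      ring
  have i1 : Integrable ((Ioi c).indicator fun _ => X₁) E.posteriorLaw :=
    integrable_indicator_of_continuous continuous_const measurableSet_Ioi
  have i2 : Integrable ((Ioi c).indicator fun s : unitInterval => (s : ℝ) - l) E.posteriorLaw :=
    integrable_indicator_of_continuous (by fun_prop) measurableSet_Ioi
  have i3 : Integrable ((Iic c).indicator fun _ => X₂) E.posteriorLaw :=
    integrable_indicator_of_continuous continuous_const measurableSet_Iic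
  have i4 : Integrable ((Iic c).indicator fun s : unitInterval => (h : ℝ) - s) E.posteriorLaw :=
    integrable_indicator_of_continuous (by fun_prop) measurableSet_Iic
  rw [payoff]
  simp_rw [key]
  have i12 : Integrable (fun s => (Ioi c).indicator (fun _ => X₁) s +
      (Ioi c).indicator (fun s : unitInterval => (s : ℝ) - l) s * Y₁) E.posteriorLaw :=
    i1.add (i2.mul_const _)
  have i34 : Integrable (fun s => (Iic c).indicator (fun _ => X₂) s -
      (Iic c).indicator (fun s : unitInterval => (h : ℝ) - s) s * Y₂) E.posteriorLaw :=
    i3.sub (i4.mul_const _)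
  rw [integral_add i12 i34,
    integral_add i1 (i2.mul_const _), integral_sub i3 (i4.mul_const _), integral_mul_const,
    integral_mul_const, integral_indicator_const _ measurableSet_Ioi,
    integral_indicator_const _ measurableSet_Iic]
  rfl

variable {K α : ℝ} {l h c : unitInterval} {k₁ k₂ : ℝ}

/-- The distribution of misaligned messages below the trust region `[l, h]`. -/
noncomputable def lowLaw (E : Model A Θ) (l : unitInterval) : Measure unitInterval :=
  tiltedLaw E.posteriorLaw fun m => max ((l : ℝ) - m) 0

/-- The distribution of misaligned messages above the trust region `[l, h]`. -/
noncomputable def highLaw (E : Model A Θ) (h : unitInterval) : Measure unitInterval :=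
  tiltedLaw E.posteriorLaw fun m => max ((m : ℝ) - h) 0

theorem integral_lowLaw (l : unitInterval) (f : unitInterval → ℝ) :
    ∫ m, f m ∂(E.lowLaw l) =
      ∫ m : unitInterval, max ((l : ℝ) - m) 0 / shortfall E.posteriorLaw l * f m ∂E.posteriorLaw :=
  integral_tiltedLaw (by fun_prop) (fun _ => le_max_right _ _) f

theorem integral_highLaw (h : unitInterval) (f : unitInterval → ℝ) :
    ∫ m, f m ∂(E.highLaw h) =
      ∫ m : unitInterval, max ((m : ℝ) - h) 0 / excess E.posteriorLaw h * f m ∂E.posteriorLaw :=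
  integral_tiltedLaw (by fun_prop) (fun _ => le_max_right _ _) f

theorem isProbabilityMeasure_lowLaw (hl : 0 < (l : ℝ)) : IsProbabilityMeasure (E.lowLaw l) :=
  isProbabilityMeasure_tiltedLaw (by fun_prop) (fun _ => le_max_right _ _)
    (shortfall_pos (τ := E.posteriorLaw) hl l.2.2)

theorem isProbabilityMeasure_highLaw (hh : (h : ℝ) < 1) : IsProbabilityMeasure (E.highLaw h) :=
  isProbabilityMeasure_tiltedLaw (by fun_prop) (fun _ => le_max_right _ _)
    (excess_pos (τ := E.posteriorLaw) h.2.1 hh)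

theorem Integrable.continuous_mul' {κ : Measure unitInterval} [IsFiniteMeasure κ]
    {f g : unitInterval → ℝ} (hg : Integrable g κ) (hf : Continuous f) :
    Integrable (fun m => f m * g m) κ := by
  obtain ⟨B, hB⟩ := isCompact_univ.exists_bound_of_continuousOn hf.continuousOn
  exact hg.bdd_mul hf.aestronglyMeasurable
    (Filter.Eventually.of_forall fun m => hB m (mem_univ m))

theorem integral_sum_sub {κ : Measure unitInterval} {f₁ f₂ f₃ f₄ f₅ : unitInterval → ℝ}
    (h₁ : Integrable f₁ κ) (h₂ : Integrable f₂ κ) (h₃ : Integrable f₃ κ) (h₄ : Integrable f₄ κ)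
    (h₅ : Integrable f₅ κ) : ∫ m, (f₁ m + f₂ m + f₃ m + f₄ m - f₅ m) ∂κ =
      ∫ m, f₁ m ∂κ + ∫ m, f₂ m ∂κ + ∫ m, f₃ m ∂κ + ∫ m, f₄ m ∂κ - ∫ m, f₅ m ∂κ := by
  have h₁₂ : Integrable (fun m => f₁ m + f₂ m) κ := h₁.add h₂
  have h₁₃ : Integrable (fun m => f₁ m + f₂ m + f₃ m) κ := h₁₂.add h₃
  have h₁₄ : Integrable (fun m => f₁ m + f₂ m + f₃ m + f₄ m) κ := h₁₃.add h₄
  rw [integral_sub h₁₄ h₅, integral_add h₁₃ h₄, integral_add h₁₂ h₃, integral_add h₁ h₂]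

/-- Against the saddle point adviser, each message outside the trust region has the posterior
of the nearest trust bound. -/
theorem payoff_saddle (H : IsSaddle E.posteriorLaw E.indirect K α l h c k₁ k₂)
    [IsProbabilityMeasure (E.lowLaw l)] [IsProbabilityMeasure (E.highLaw h)] (hα : α < 1)
    (σ : Strategy (unitInterval × Θ) A) :
    α * E.payoff truthful σ + (1 - α) * E.payoff (cutoffAdviser c (E.lowLaw l) (E.highLaw h)) σ =
      ∫ m, messageDensity E.posteriorLaw α l h c m *
        E.privatePayoff (privateOf σ m) (clamp l h m) ∂E.posteriorLaw := by
  have hlh := H.left_le.trans H.le_right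
  have hs := (shortfall_pos (τ := E.posteriorLaw) (H.pos hα) l.2.2).ne'
  have he := (excess_pos (τ := E.posteriorLaw) h.2.1 (H.lt_one hα)).ne'
  have hslope := E.integrable_slope σ E.posteriorLaw
  have hP : ∀ {f : unitInterval → unitInterval}, Measurable f →
      Integrable (fun m => E.privatePayoff (privateOf σ m) (f m)) E.posteriorLaw :=
    fun hf => E.integrable_message σ _ hf
  rw [payoff_truthful, payoff_cutoffAdviser σ l h c]
  simp only [integral_lowLaw, integral_highLaw]
  have e1 := H.low
  have e2 := H.high
  set N := E.posteriorLaw.real (Ioi c)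
  set N' := E.posteriorLaw.real (Iic c)
  set S := shortfall E.posteriorLaw l
  set X := excess E.posteriorLaw h
  have j1 := (hP (f := fun m => m) measurable_id).const_mul α
  have j2 := (Integrable.continuous_mul' (hP (f := fun _ => l) measurable_const)
    ((continuous_shortfallIntegrand l).div_const S)).const_mul ((1 - α) * N)
  have j3 := (Integrable.continuous_mul' hslope
    ((continuous_shortfallIntegrand l).div_const S)).const_mul (α * S)
  have j4 := (Integrable.continuous_mul' (hP (f := fun _ => h) measurable_const)
    ((continuous_excessIntegrand h).div_const X)).const_mul ((1 - α) * N')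
  have j5 := (Integrable.continuous_mul' hslope
    ((continuous_excessIntegrand h).div_const X)).const_mul (α * X)
  -- The first-order conditions trade the gaps, weighted by `1 - α`, for shortfall and excess
  -- weighted by `α`; these cancel the normalizing constants of the message laws.
  have expand : ∀ a b b' d e : ℝ, α * a + (1 - α) * (N * b + upperGap E.posteriorLaw c l * b' +
      (N' * d - lowerGap E.posteriorLaw c h * e)) =
      α * a + (1 - α) * N * b + α * S * b' + (1 - α) * N' * d - α * X * e := by
    intro a b b' d e
    linear_combination (-b') * e1 + e * e2
  rw [expand, ← integral_const_mul, ← integral_const_mul, ← integral_const_mul,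
    ← integral_const_mul, ← integral_const_mul, ← integral_sum_sub j1 j2 j3 j4 j5]
  refine integral_congr_ae (Filter.Eventually.of_forall fun m => ?_)
  simp only [messageDensity]
  have hlow : max ((l : ℝ) - m) 0 * E.privatePayoff (privateOf σ m) l =
      max ((l : ℝ) - m) 0 * E.privatePayoff (privateOf σ m) (clamp l h m) := by
    rcases le_total m l with hm | hm
    · rw [clamp_of_le hm]
    · rw [max_eq_right (sub_nonpos.2 (Subtype.coe_le_coe.2 hm)), zero_mul, zero_mul]
  have hhigh : max ((m : ℝ) - h) 0 * E.privatePayoff (privateOf σ m) h =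
      max ((m : ℝ) - h) 0 * E.privatePayoff (privateOf σ m) (clamp l h m) := by
    rcases le_total h m with hm | hm
    · rw [clamp_of_ge hlh hm]
    · rw [max_eq_right (sub_nonpos.2 (Subtype.coe_le_coe.2 hm)), zero_mul, zero_mul]
  have hline := privatePayoff_eq_line (E := E) (privateOf σ m) (m : ℝ) (clamp l h m : ℝ)
  have hc := coe_clamp hlh m
  have g1 : α * S * (max ((l : ℝ) - m) 0 / S * E.slope (privateOf σ m)) =
      α * max ((l : ℝ) - m) 0 * E.slope (privateOf σ m) := by
    field_simp
  have g2 : α * X * (max ((m : ℝ) - h) 0 / X * E.slope (privateOf σ m)) =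
      α * max ((m : ℝ) - h) 0 * E.slope (privateOf σ m) := by
    field_simp
  -- The slope terms thus move the truthful payoff at `m` along its line from belief `m` to `clamp l
  -- h m`.
  have hc' : (clamp l h m : ℝ) - m = max ((l : ℝ) - m) 0 - max ((m : ℝ) - h) 0 := by
    rw [hc]; ring
  rw [hc'] at hline
  rw [g1, g2]
  linear_combination ((1 - α) * N / S) * hlow + ((1 - α) * N' / X) * hhigh - α * hline

end Model

/-! ### Optimal strategies and uniqueness of the trust interval. -/

namespace Model

section Optimality

variable {A Θ : Type*} [TopologicalSpace A] [MeasurableSpace A] [MeasurableSpace Θ]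
  {E : Model A Θ} {K α : ℝ} {l h c : unitInterval} {k₁ k₂ : ℝ}

theorem messageDensity_one (τ : Measure unitInterval) (l h c m : unitInterval) :
    messageDensity τ 1 l h c m = 1 := by
  simp [messageDensity]

theorem guarantee_one (σ : Strategy (unitInterval × Θ) A) :
    E.guarantee 1 σ = E.payoff truthful σ := by
  simp [guarantee]

theorem payoff_truthful_eq (hm : ∀ m : unitInterval, clamp l h m = m)
    (σ : Strategy (unitInterval × Θ) A) :
    E.payoff truthful σ = ∫ m, messageDensity E.posteriorLaw 1 l h c m *
      E.privatePayoff (privateOf σ m) (clamp l h m) ∂E.posteriorLaw := by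
  simp only [payoff_truthful, messageDensity_one, hm, one_mul]

theorem clamp_zero_one (m : unitInterval) : clamp 0 1 m = m := clamp_of_mem ⟨m.2.1, m.2.2⟩

/-- The infimum is at most the payoff against the saddle point adviser. At `α = 1` his message laws
degenerate, but then clamping is the identity and only truthful reports count. -/
theorem guarantee_le (H : IsSaddle E.posteriorLaw E.indirect K α l h c k₁ k₂) (hα : α ≤ 1)
    (σ : Strategy (unitInterval × Θ) A) :
    E.guarantee α σ ≤ ∫ m, messageDensity E.posteriorLaw α l h c m *
      E.privatePayoff (privateOf σ m) (clamp l h m) ∂E.posteriorLaw := by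
  rcases hα.eq_or_lt with rfl | hα
  · obtain ⟨rfl, rfl⟩ := H.eq_of_one
    rw [guarantee_one, payoff_truthful_eq clamp_zero_one]
  · have := isProbabilityMeasure_lowLaw (E := E) (H.pos hα)
    have := isProbabilityMeasure_highLaw (E := E) (H.lt_one hα)
    rw [← payoff_saddle H hα, guarantee]
    have := mul_le_mul_of_nonneg_left (ciInf_le (E.bddBelow_payoff σ)
      (cutoffAdviser c (E.lowLaw l) (E.highLaw h))) (sub_nonneg.2 hα.le)
    linarith

theorem integrable_weighted (σ : Strategy (unitInterval × Θ) A) (α : ℝ) (l h c : unitInterval) :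
    Integrable (fun m => messageDensity E.posteriorLaw α l h c m *
      E.privatePayoff (privateOf σ m) (clamp l h m)) E.posteriorLaw :=
  Integrable.continuous_mul' (E.integrable_message σ _ (continuous_clamp l h).measurable)
    (continuous_messageDensity α l h c)

theorem integrable_weighted_indirect (hV : Continuous fun s : unitInterval => E.indirect s)
    (α : ℝ) (l h c : unitInterval) :
    Integrable (fun m => messageDensity E.posteriorLaw α l h c m *
      E.indirect (clamp l h m)) E.posteriorLaw :=
  integrable_of_continuous ((continuous_messageDensity α l h c).mul (hV.comp (continuous_clamp l h)))

theorem integral_weighted_le (hV : Continuous fun s : unitInterval => E.indirect s)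
    (h0 : 0 ≤ α) (h1 : α ≤ 1) (σ : Strategy (unitInterval × Θ) A) (l h c : unitInterval) :
    ∫ m, messageDensity E.posteriorLaw α l h c m *
      E.privatePayoff (privateOf σ m) (clamp l h m) ∂E.posteriorLaw ≤
    ∫ m, messageDensity E.posteriorLaw α l h c m * E.indirect (clamp l h m) ∂E.posteriorLaw :=
  integral_mono (integrable_weighted σ α l h c) (integrable_weighted_indirect hV α l h c) fun _ =>
    mul_le_mul_of_nonneg_left (privatePayoff_le_indirect _ _) (h0.trans (le_messageDensity h1 _ _ _ _))

/-- A strategy that attains the upper bound on the guarantee responds to almost every message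
Bayes-optimally for the nearest belief in the trust region. -/
theorem ae_isBayesOptimal (hV : Continuous fun s : unitInterval => E.indirect s)
    (H : IsSaddle E.posteriorLaw E.indirect K α l h c k₁ k₂) (h0 : 0 < α) (h1 : α ≤ 1)
    {σ : Strategy (unitInterval × Θ) A}
    (hσ : ∫ m, messageDensity E.posteriorLaw α l h c m * E.indirect (clamp l h m) ∂E.posteriorLaw ≤
      E.guarantee α σ) :
    ∀ᵐ m ∂E.posteriorLaw, E.IsBayesOptimal (privateOf σ m) (clamp l h m) := by
  have heq := le_antisymm (integral_weighted_le hV h0.le h1 σ l h c) (hσ.trans (guarantee_le H h1 σ))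
  have hae := (integral_eq_iff_of_ae_le (integrable_weighted σ α l h c)
    (integrable_weighted_indirect hV α l h c) (Filter.Eventually.of_forall fun _ =>
      mul_le_mul_of_nonneg_left (privatePayoff_le_indirect _ _)
        (h0.le.trans (le_messageDensity h1 _ _ _ _)))).1 heq
  filter_upwards [hae] with m hm
  exact isBayesOptimal_iff.2
    (mul_left_cancel₀ (h0.trans_le (le_messageDensity h1 _ _ _ _)).ne' hm)

theorem slope_eq (hd : DifferentiableOn ℝ E.indirect (Ioo (0 : ℝ) 1)) {p q : unitInterval} {k : ℝ}
    (hp : (p : ℝ) ∈ Ioo (0 : ℝ) 1) (hk : IsSubgradient E.indirect p k) {ρ : Strategy Θ A}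
    (hρ : E.IsBayesOptimal ρ q) (hq : q = p) : E.slope ρ = k := by
  subst hq
  have hdp := hd.differentiableAt (Ioo_mem_nhds hp.1 hp.2)
  rw [hρ.isSubgradient.eq_deriv hp hdp, hk.eq_deriv hp hdp]

/-- If `q ≤ s`, the line with contact point further right is higher at `s`. If `s < q`, the line at
`q` is above the line at `h`, which beyond the crossing `c` is above the line at `l`. -/
theorem line_left_le (hd : DifferentiableOn ℝ E.indirect (Ioo (0 : ℝ) 1))
    (H : IsSaddle E.posteriorLaw E.indirect K α l h c k₁ k₂) (hα : α < 1) {q s : unitInterval}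
    (hq : q ∈ Icc l h) (hs : c ≤ s) {ρ : Strategy Θ A} (hρ : E.IsBayesOptimal ρ q) :
    E.indirect l + k₁ * (s - l) ≤ E.privatePayoff ρ s := by
  have hlc : (l : ℝ) ≤ c := H.left_le
  have hch : (c : ℝ) ≤ h := H.le_right
  have hs' : (c : ℝ) ≤ s := hs
  rw [hρ.line]
  rcases hq.1.eq_or_lt with e | hlq
  · rw [slope_eq hd (H.mem_Ioo_left hα) H.subgradient₁ hρ e.symm, e]
  rcases le_or_gt q s with hqs | hqs
  · exact H.subgradient₁.line_le_right hρ.isSubgradient l.2 q.2 hlq hqs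
  · have hqh : (q : ℝ) ≤ h := hq.2
    have hlq' : (l : ℝ) < q := hlq
    have hqs' : (s : ℝ) < q := hqs
    have h1 : E.indirect h + k₂ * (s - h) ≤ E.indirect q + E.slope ρ * (s - q) := by
      rcases hq.2.eq_or_lt with e | hqh
      · rw [slope_eq hd (H.mem_Ioo_right hα) H.subgradient₂ hρ e, e]
      · exact hρ.isSubgradient.line_le_left H.subgradient₂ q.2 h.2 hqh hqs'.le
    have h2 := mul_le_mul_of_nonneg_right
      (H.subgradient₁.slope_le H.subgradient₂ l.2 h.2 (by linarith)) (sub_nonneg.2 hs')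
    have := H.cross
    linarith

theorem line_right_le (hd : DifferentiableOn ℝ E.indirect (Ioo (0 : ℝ) 1))
    (H : IsSaddle E.posteriorLaw E.indirect K α l h c k₁ k₂) (hα : α < 1) {q s : unitInterval}
    (hq : q ∈ Icc l h) (hs : s ≤ c) {ρ : Strategy Θ A} (hρ : E.IsBayesOptimal ρ q) :
    E.indirect h + k₂ * (s - h) ≤ E.privatePayoff ρ s := by
  have hlc : (l : ℝ) ≤ c := H.left_le
  have hch : (c : ℝ) ≤ h := H.le_right
  have hs' : (s : ℝ) ≤ c := hs
  rw [hρ.line]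
  rcases hq.2.eq_or_lt with e | hqh
  · rw [slope_eq hd (H.mem_Ioo_right hα) H.subgradient₂ hρ e, e]
  rcases le_or_gt s q with hqs | hqs
  · exact hρ.isSubgradient.line_le_left H.subgradient₂ q.2 h.2 hqh hqs
  · have hlq : (l : ℝ) ≤ q := hq.1
    have hqh' : (q : ℝ) < h := hqh
    have hqs' : (q : ℝ) < s := hqs
    have h1 : E.indirect l + k₁ * (s - l) ≤ E.indirect q + E.slope ρ * (s - q) := by
      rcases hq.1.eq_or_lt with e | hlq
      · rw [slope_eq hd (H.mem_Ioo_left hα) H.subgradient₁ hρ e.symm, e]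
      · exact H.subgradient₁.line_le_right hρ.isSubgradient l.2 q.2 hlq hqs'.le
    have h2 := mul_le_mul_of_nonneg_right
      (H.subgradient₁.slope_le H.subgradient₂ l.2 h.2 (by linarith)) (sub_nonneg.2 hs')
    have := H.cross
    linarith

/-- The saddle point adviser minimizes the payoff of a strategy that responds Bayes-optimally to
the nearest belief in the trust region. -/
theorem payoff_cutoffAdviser_le (hd : DifferentiableOn ℝ E.indirect (Ioo (0 : ℝ) 1))
    (H : IsSaddle E.posteriorLaw E.indirect K α l h c k₁ k₂)
    [IsProbabilityMeasure (E.lowLaw l)] [IsProbabilityMeasure (E.highLaw h)] (hα : α < 1)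
    {σ : Strategy (unitInterval × Θ) A}
    (hσ : ∀ m, E.IsBayesOptimal (privateOf σ m) (clamp l h m))
    (β : Strategy unitInterval unitInterval) :
    E.payoff (cutoffAdviser c (E.lowLaw l) (E.highLaw h)) σ ≤ E.payoff β σ := by
  have hlh := H.left_le.trans H.le_right
  refine integral_mono (E.integrable_payoff _ σ) (E.integrable_payoff β σ) fun s => ?_
  have := β.2
  have hconst : ∀ (κ : Measure unitInterval) [IsProbabilityMeasure κ] (x : ℝ), ∫ _, x ∂κ = x := by
    intro κ _ x; simp
  have hi := E.integrable_message σ (β.1 s) (f := fun _ => s) measurable_const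
  rcases lt_or_ge c s with hs | hs
  · simp only [cutoffAdviser_apply_of_lt _ _ hs]
    have e : ∫ m, E.privatePayoff (privateOf σ m) s ∂(E.lowLaw l) =
        E.indirect l + k₁ * (s - l) := by
      -- Low messages have no weight at or above `l`, and below `l` the response is the supporting
      -- line at `l`.
      rw [← hconst (E.lowLaw l) (E.indirect l + k₁ * (s - l)), integral_lowLaw, integral_lowLaw]
      refine integral_congr_ae (Filter.Eventually.of_forall fun m => ?_)
      simp only
      rcases le_total m l with hm | hm
      · rw [(hσ m).line, slope_eq hd (H.mem_Ioo_left hα) H.subgradient₁ (hσ m) (clamp_of_le hm),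
          clamp_of_le hm]
      · rw [max_eq_right (sub_nonpos.2 (Subtype.coe_le_coe.2 hm)), zero_div, zero_mul, zero_mul]
    rw [e, ← hconst (β.1 s) (E.indirect l + k₁ * (s - l))]
    exact integral_mono (integrable_const _) hi fun m =>
      line_left_le hd H hα (clamp_mem hlh m) hs.le (hσ m)
  · simp only [cutoffAdviser_apply_of_le _ _ hs]
    have e : ∫ m, E.privatePayoff (privateOf σ m) s ∂(E.highLaw h) =
        E.indirect h + k₂ * (s - h) := by
      rw [← hconst (E.highLaw h) (E.indirect h + k₂ * (s - h)), integral_highLaw, integral_highLaw]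
      refine integral_congr_ae (Filter.Eventually.of_forall fun m => ?_)
      simp only
      rcases le_total h m with hm | hm
      · rw [(hσ m).line, slope_eq hd (H.mem_Ioo_right hα) H.subgradient₂ (hσ m)
          (clamp_of_ge hlh hm), clamp_of_ge hlh hm]
      · rw [max_eq_right (sub_nonpos.2 (Subtype.coe_le_coe.2 hm)), zero_div, zero_mul, zero_mul]
    rw [e, ← hconst (β.1 s) (E.indirect h + k₂ * (s - h))]
    exact integral_mono (integrable_const _) hi fun m =>
      line_right_le hd H hα (clamp_mem hlh m) hs (hσ m)

theorem le_guarantee (hd : DifferentiableOn ℝ E.indirect (Ioo (0 : ℝ) 1))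
    (H : IsSaddle E.posteriorLaw E.indirect K α l h c k₁ k₂) (hα : α ≤ 1)
    {σ : Strategy (unitInterval × Θ) A}
    (hσ : ∀ m, E.IsBayesOptimal (privateOf σ m) (clamp l h m)) :
    ∫ m, messageDensity E.posteriorLaw α l h c m * E.indirect (clamp l h m) ∂E.posteriorLaw ≤
      E.guarantee α σ := by
  simp_rw [← isBayesOptimal_iff.1 (hσ _)]
  rcases hα.eq_or_lt with rfl | hα
  · obtain ⟨rfl, rfl⟩ := H.eq_of_one
    rw [guarantee_one, payoff_truthful_eq clamp_zero_one]
  · have := isProbabilityMeasure_lowLaw (E := E) (H.pos hα)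
    have := isProbabilityMeasure_highLaw (E := E) (H.lt_one hα)
    have : Nonempty (Strategy unitInterval unitInterval) := ⟨truthful⟩
    rw [← payoff_saddle H hα, guarantee]
    have := mul_le_mul_of_nonneg_left (le_ciInf (payoff_cutoffAdviser_le hd H hα hσ))
      (sub_nonneg.2 hα.le)
    linarith

/-- The strategy that applies `σ` to the belief in `[l, h]` nearest to the message. -/
noncomputable def clampStrategy (σ : Strategy (unitInterval × Θ) A) (l h : unitInterval) :
    Strategy (unitInterval × Θ) A :=
  ⟨σ.1.comap (fun q => (clamp l h q.1, q.2))
    (((continuous_clamp l h).measurable.comp measurable_fst).prodMk measurable_snd),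
    have := σ.2; Kernel.IsMarkovKernel.comap _ _⟩

omit [TopologicalSpace A] in
theorem privateOf_clampStrategy (σ : Strategy (unitInterval × Θ) A) (l h m : unitInterval) :
    privateOf (clampStrategy σ l h) m = privateOf σ (clamp l h m) := rfl

/-- At a belief outside the interval, the supporting line at the nearest bound is the highest of the
lines at trusted beliefs. -/
theorem isTrustRegionStrategy_clampStrategy {σ : Strategy (unitInterval × Θ) A}
    (hσ : ∀ p, E.IsBayesOptimal (privateOf σ p) p) (hlh : l ≤ h) :
    E.IsTrustRegionStrategy (clampStrategy σ l h) (Icc l h) := by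
  refine ⟨isCompact_Icc, fun m hm => ?_, fun m hm => ?_⟩
  · rw [privateOf_clampStrategy, clamp_of_mem hm]
    exact hσ m
  rcases lt_or_ge m l with hml | hml
  · refine ⟨l, left_mem_Icc.2 hlh, fun m' hm' => ?_, ?_⟩
    · rw [privateOf_clampStrategy, privateOf_clampStrategy, clamp_of_mem hm',
        clamp_of_le le_rfl]
      rcases hm'.1.eq_or_lt with rfl | hlt
      · exact le_rfl
      · rw [(hσ m').line, (hσ l).line]
        exact (hσ l).isSubgradient.line_le_left (hσ m').isSubgradient l.2 m'.2 hlt hml.le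
    · rw [privateOf_clampStrategy, clamp_of_le hml.le]
      exact hσ l
  · have hmh : h < m := not_le.1 fun hmh => hm ⟨hml, hmh⟩
    refine ⟨h, right_mem_Icc.2 hlh, fun m' hm' => ?_, ?_⟩
    · rw [privateOf_clampStrategy, privateOf_clampStrategy, clamp_of_mem hm',
        clamp_of_ge hlh le_rfl]
      rcases hm'.2.eq_or_lt with rfl | hlt
      · exact le_rfl
      · rw [(hσ m').line, (hσ h).line]
        exact (hσ m').isSubgradient.line_le_right (hσ h).isSubgradient m'.2 h.2 hlt hmh.le
    · rw [privateOf_clampStrategy, clamp_of_ge hlh hmh.le]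
      exact hσ h

/-- A saddle point pins down the trust interval. -/
theorem isTrustInterval_iff (hV : StrictConvexOn ℝ (Icc (0 : ℝ) 1) E.indirect)
    (hc : Continuous fun s : unitInterval => E.indirect s)
    (hd : DifferentiableOn ℝ E.indirect (Ioo (0 : ℝ) 1))
    {σ₀ : Strategy (unitInterval × Θ) A} (hσ₀ : ∀ p, E.IsBayesOptimal (privateOf σ₀ p) p)
    (H : IsSaddle E.posteriorLaw E.indirect K α l h c k₁ k₂) (h0 : 0 < α) (h1 : α ≤ 1)
    (l' h' : unitInterval) : E.IsTrustInterval α l' h' ↔ l' = l ∧ h' = h := by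
  have hlh := H.left_le.trans H.le_right
  have hopt : ∫ m, messageDensity E.posteriorLaw α l h c m * E.indirect (clamp l h m)
      ∂E.posteriorLaw ≤ E.guarantee α (clampStrategy σ₀ l h) :=
    le_guarantee hd H h1 fun m => hσ₀ (clamp l h m)
  constructor
  · rintro ⟨hlh', σ, hσ, -, hin, hout⟩
    have hae := ae_isBayesOptimal hc H h0 h1 (hopt.trans (hσ (clampStrategy σ₀ l h)))
    -- Either way the response is Bayes-optimal for some belief of `[l', h']`, the message itself if
    -- it is trusted; that belief must be `clamp l h m`.
    have hclose : ∀ m, E.IsBayesOptimal (privateOf σ m) (clamp l h m) →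
        clamp l h m ∈ Icc l' h' ∧ (m ∈ Icc l' h' → clamp l h m = m) := by
      intro m hm
      by_cases hmT : m ∈ Icc l' h'
      · have e := hm.unique hV (hin m hmT)
        exact ⟨by rwa [e], fun _ => e⟩
      · obtain ⟨p, hp, -, hpm⟩ := hout m hmT
        exact ⟨by rwa [hm.unique hV hpm], fun h => absurd h hmT⟩
    have hdense := Measure.dense_of_ae hae
    -- Full support makes the good messages dense, and the property is closed. In particular `[l, h]
    -- ⊆ [l', h']`.
    have hall : ∀ m, clamp l h m ∈ Icc l' h' := fun m =>
      closure_minimal (fun m hm => (hclose m hm).1)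
        (isClosed_Icc.preimage (continuous_clamp l h)) (hdense m)
    have hl := hall l
    have hh := hall h
    rw [clamp_of_le le_rfl] at hl
    rw [clamp_of_ge hlh le_rfl] at hh
    refine ⟨le_antisymm hl.1 (not_lt.1 fun hlt => ?_), le_antisymm (not_lt.1 fun hlt => ?_) hh.2⟩
    -- A good message strictly between `l'` and `l` would be trusted as itself yet clamped to `l`.
    · obtain ⟨m, hm, hmb⟩ := hdense.inter_open_nonempty (Ioo l' l) isOpen_Ioo
        (nonempty_Ioo.2 hlt)
      have e := (hclose m hmb).2 ⟨hm.1.le, hm.2.le.trans hl.2⟩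
      rw [clamp_of_le hm.2.le] at e
      exact hm.2.ne' e
    · obtain ⟨m, hm, hmb⟩ := hdense.inter_open_nonempty (Ioo h h') isOpen_Ioo
        (nonempty_Ioo.2 hlt)
      have e := (hclose m hmb).2 ⟨hh.1.trans hm.1.le, hm.2.le⟩
      rw [clamp_of_ge hlh hm.1.le] at e
      exact hm.1.ne e
  · rintro ⟨rfl, rfl⟩
    exact ⟨hlh, clampStrategy σ₀ l' h', fun σ' =>
      (guarantee_le H h1 σ').trans ((integral_weighted_le hc h0.le h1 σ' l' h' c).trans hopt),
      isTrustRegionStrategy_clampStrategy hσ₀ hlh⟩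

end Optimality

end Model

end TrustRegion

/-! ### The change in alignment. -/

theorem mainTheorem5 {A Θ : Type*}
    [MetricSpace A] [CompactSpace A] [Nonempty A] [MeasurableSpace A] [BorelSpace A]
    [MetricSpace Θ] [CompactSpace Θ] [MeasurableSpace Θ] [BorelSpace Θ]
    (E : TrustRegion.Model A Θ)
    (hconvex : StrictConvexOn ℝ (Icc (0 : ℝ) 1) E.indirect)
    (hdiff : DifferentiableOn ℝ E.indirect (Ioo (0 : ℝ) 1))
    (hdiff2 : DifferentiableOn ℝ (deriv E.indirect) (Ioo (0 : ℝ) 1)) :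
    ∃ lo hi : ℝ → unitInterval,
      (∀ α ∈ Icc (1 / 2 : ℝ) 1, ∀ l h : unitInterval,
        E.IsTrustInterval α l h ↔ l = lo α ∧ h = hi α) ∧
      StrictAntiOn lo (Icc (1 / 2 : ℝ) 1) ∧ ContinuousOn lo (Icc (1 / 2 : ℝ) 1) ∧
      StrictMonoOn hi (Icc (1 / 2 : ℝ) 1) ∧ ContinuousOn hi (Icc (1 / 2 : ℝ) 1) ∧
      lo (1 / 2) = E.prior ∧ hi (1 / 2) = E.prior ∧
      lo 1 = 0 ∧ hi 1 = 1 := by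
  open TrustRegion TrustRegion.Model in
  obtain ⟨σ₀, hσ₀⟩ := E.exists_bayesOptimal
  obtain ⟨C, hC⟩ := E.bounded_u
  have hsub : ∀ p : unitInterval, IsSubgradient E.indirect p (E.slope (privateOf σ₀ p)) :=
    fun p => (hσ₀ p).isSubgradient
  have hbd : ∀ p : unitInterval, |E.slope (privateOf σ₀ p)| ≤ 2 * C := fun p => abs_slope_le hC _
  have hcont := continuous_of_bounded_subgradients hsub hbd
  -- The implication inside the existential makes the chosen bounds total functions, with junk
  -- values off `[1/2, 1]`.
  have hex : ∀ α : ℝ, ∃ l h : unitInterval, α ∈ Icc (1 / 2 : ℝ) 1 →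
      ∃ c k₁ k₂, IsSaddle E.posteriorLaw E.indirect (2 * C) α l h c k₁ k₂ := by
    intro α
    by_cases hα : α ∈ Icc (1 / 2 : ℝ) 1
    · obtain ⟨l, h, hlh⟩ := exists_isSaddle (τ := E.posteriorLaw) hsub hbd hcont hdiff
        hdiff2.continuousOn hα
      exact ⟨l, h, fun _ => hlh⟩
    · exact ⟨0, 0, fun h => absurd h hα⟩
  choose lo hi hsaddle using hex
  have hpos : ∀ α ∈ Icc (1 / 2 : ℝ) 1, 0 < α := fun α hα => by linarith [hα.1]
  have hiff : ∀ α ∈ Icc (1 / 2 : ℝ) 1, ∀ l h : unitInterval,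
      E.IsTrustInterval α l h ↔ l = lo α ∧ h = hi α := by
    intro α hα l h
    obtain ⟨c, k₁, k₂, H⟩ := hsaddle α hα
    exact isTrustInterval_iff hconvex hcont hdiff hσ₀ H (hpos α hα) hα.2 l h
  -- Every saddle point yields a trust interval, so uniqueness of the latter makes the saddle bounds
  -- unique.
  have huniq : ∀ α ∈ Icc (1 / 2 : ℝ) 1, ∀ l h c k₁ k₂,
      IsSaddle E.posteriorLaw E.indirect (2 * C) α l h c k₁ k₂ → l = lo α ∧ h = hi α := by
    intro α hα l h c k₁ k₂ H
    exact (hiff α hα l h).1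
      ((isTrustInterval_iff hconvex hcont hdiff hσ₀ H (hpos α hα) hα.2 l h).2 ⟨rfl, rfl⟩)
  have hmono : ∀ α ∈ Icc (1 / 2 : ℝ) 1, ∀ α' ∈ Icc (1 / 2 : ℝ) 1, α < α' →
      (lo α' : ℝ) < lo α ∧ (hi α : ℝ) < hi α' := by
    intro α hα α' hα' hlt
    obtain ⟨c, k₁, k₂, H⟩ := hsaddle α hα
    obtain ⟨c', k₁', k₂', H'⟩ := hsaddle α' hα'
    exact H.lt_of_lt hconvex hdiff H' (hpos α hα).le hlt hα'.2
  have hcts := continuousOn_of_isSaddle (τ := E.posteriorLaw) hcont hsaddle huniq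
  obtain ⟨c, k₁, k₂, H⟩ := hsaddle (1 / 2) (by norm_num)
  obtain ⟨c', k₁', k₂', H'⟩ := hsaddle 1 (by norm_num)
  have hhalf := H.eq_mean
  rw [E.integral_coe_posteriorLaw] at hhalf
  exact ⟨lo, hi, hiff, fun α hα α' hα' hlt => (hmono α hα α' hα' hlt).1, hcts.1,
    fun α hα α' hα' hlt => (hmono α hα α' hα' hlt).2, hcts.2, Subtype.ext hhalf.1,
    Subtype.ext hhalf.2, H'.eq_of_one.1, H'.eq_of_one.2⟩
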